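/- **Setting.** Let $G$ be a countable infinite discrete group. *Rank one.* Let $T=(T_g)_{g\in G}$ be a nonsingular action of $G$ on a standard $\sigma$-finite non-atomic measure space $(Z,\eta)$ that is free (almost every point has trivial stabilizer). A *Rokhlin tower* is a pair $(B,F)$ with $B\subset Z$ Borel, $0<\eta(B)<\infty$, $F\subset G$ finite, $1_G\in F$, the sets $T_fB$ ($f\in F$) pairwise disjoint, and $\frac{d\eta\circ T_f}{d\eta}$ a.e. constant on $B$ for each $f\in F$. For $x\in T_fB$, $f\in F$, put $O_{B,F}(x)=\{T_gx: g\in Ff^{-1}\}$. Let $\{1_G\}=Q_0\subset Q_1\subset Q_2\subset\cdots$ be finite subsets of $G$. The action $T$ is *of rank one along* $(Q_n)$ if there are $B_0\supset B_1\supset\cdots$ such that every $(B_n,Q_n)$ is a Rokhlin tower and 1. for each $n$, every level $T_fB_n$ ($f\in Q_n$) is (mod 0) a union of levels $T_hB_{n+1}$ ($h\in Q_{n+1}$), and, off a null set, the towers cover $Z$ and their levels separate points; 2. for a.e. $x$ and every $g\in G$, $T_gx\in O_{B_n,Q_n}(x)$ for all sufficiently large $n$. *$(C,F)$-actions.* Let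 $(F_n)_{n\ge0}$ and $(C_n)_{n\ge1}$ be finite subsets of $G$ such that $F_0=\{1_G\}$, $1_G\in F_n\cap C_n$ and $\#C_n>1$ for $n\ge1$, and, for all $n\ge 0$, $F_nC_{n+1}\subset F_{n+1}$ and $F_nc\cap F_nc'=\emptyset$ for distinct $c,c'\in C_{n+1}$. Let $X$ be the topological inductive limit of the spaces $X_n=F_n\times C_{n+1}\times C_{n+2}\times\cdots$ (product topology) along the embeddings $(f_n,c_{n+1},c_{n+2},\dots)\mapsto(f_nc_{n+1},c_{n+2},\dots)$, and let $[f]_n\subset X_n$ be the set of points with first coordinate $f$. Assume $(\ast)$ for each $g\in G$ and $n>0$ there is $m>n$ with $gF_nC_{n+1}\cdots C_m\subset F_m$. The *$(C,F)$-action* on $X$ is $T_g(f_n,c_{n+1},\dots)=(gf_n,c_{n+1},\dots)$ whenever $f_n,gf_n\in F_n$. Given weights $\kappa_n>0$ on $C_n$ ($n\ge1$) with total mass $1$ and $\nu_n>0$ on $F_n$ ($n\ge0$), such that $\prod_{n>0}\max_{c\in C_n}\kappa_n(c)=0$ and $\nu_{n+1}(fc)=\nu_n(f)\kappa_{n+1}(c)$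 for $f\in F_n$, $c\in C_{n+1}$, the *$(C,F)$-measure* is the Borel measure $\mu$ on $X$ with $\mu([f]_n)=\nu_n(f)$ for all $n\ge 0$ and $f\in F_n$. *Unique ergodicity.* A *locally compact Cantor space* is a nonempty locally compact, second countable, Hausdorff, totally disconnected space without isolated points. A continuous action on such a space is *Radon uniquely ergodic* if it has a nonzero invariant Radon measure and every invariant Radon measure is a multiple of it. For a cocycle $\rho$, that is, Borel maps $\rho_g>0$ with $\rho_{g_2}(g_1x)\rho_{g_1}(x)=\rho_{g_2g_1}(x)$, the action is *Radon $\rho$-uniquely ergodic* if, up to scaling, there is exactly one nonzero quasi-invariant Radon measure $\gamma$ with $\frac{d\gamma\circ g}{d\gamma}=\rho_g$ a.e. for all $g\in G$. **Theorem 1.19 (Theorem B).** Let a free nonsingular action $R$ of $G$ on a standard $\sigma$-finite non-atomic measure space $(Z,\eta)$ be of rank one along $(Q_n)_{n\ge0}$. Then there are sequences $(C_n',F_{n-1}',\kappa_n',\nu_{n-1}')_{n\ge1}$ as above, satisfying $(\ast)$, whose $(C,F)$-space $X'$, $(C,F)$-action $T'$ and $(C,F)$-measure $\mu'$ have the following properties.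 1. $X'$ is a locally compact Cantor space. The action $T'$ is continuous, minimal, free (every point has trivial stabilizer) and Radon uniquely ergodic. There is exactly one $T'$-invariant Radon measure $\xi$ with $\xi(X'_0)=1$, where $X'_0$ is the image of $F_0'\times C_1'\times C_2'\times\cdots$. 2. $\mu'$ is a $T'$-quasi-invariant Radon measure. The Radon–Nikodym derivatives $\rho_g=\frac{d\mu'\circ T'_g}{d\mu'}:X'\to(0,\infty)$ are continuous (that is, have continuous versions forming a cocycle). 3. There is a measure-preserving Borel isomorphism $\varphi$ of $(Z,\eta)$ onto $(X',\mu')$ with $\varphi R_g=T'_g\varphi$ a.e. for each $g\in G$. 4. There are $z_n\in Q_n$ such that $(F_n')_{n\ge1}$ is a subsequence of $(Q_nz_n^{-1})_{n\ge1}$. 5. $T'$ is Radon $(\rho_g)_{g\in G}$-uniquely ergodic. Thus $\mu'$ is, up to scaling, the only nonzero quasi-invariant Radon measure with Radon–Nikodym cocycle $(\rho_g)$. -/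

import Mathlib

open MeasureTheory Set Filter Topology
open scoped NNReal ENNReal Pointwise

noncomputable section

namespace RankOne

/-! ### Actions on measure spaces -/

section Actions

variable {G : Type*} [Group G] {X : Type*} [MeasurableSpace X] [MulAction G X]

/-- The measure `μ ∘ T_g`, that is `A ↦ μ (T_g A)`, written as the image of `μ` under `T_g⁻¹`. -/
def compMeasure (μ : Measure X) (g : G) : Measure X :=
  μ.map (fun x : X => g⁻¹ • x)

variable (G) in
/-- The action is by measurable maps that preserve the class of `μ`. Since the condition is imposed
for `g` and for `g⁻¹`, it says `μ ∘ T_g ∼ μ` for every `g`. -/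
def QuasiInvariant (μ : Measure X) : Prop :=
  ∀ g : G, Measure.QuasiMeasurePreserving (fun x : X => g • x) μ μ

variable (G) in
/-- Freeness of a measured action: almost every point has a trivial stabilizer. -/
def FreeAE (μ : Measure X) : Prop :=
  ∀ g : G, g ≠ 1 → ∀ᵐ x ∂μ, g • x ≠ x

/-- `(B, F)` is a Rokhlin tower: the levels `T_f B`, `f ∈ F`, are disjoint, and each derivative
`d(μ ∘ T_f)/dμ`, `f ∈ F`, is (a.e.) constant on `B`. -/
structure IsRokhlinTower (μ : Measure X) (B : Set X) (F : Finset G) : Prop where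
  measurableSet : MeasurableSet B
  pos : 0 < μ B
  lt_top : μ B < ∞
  one_mem : (1 : G) ∈ F
  disjoint : ∀ f ∈ F, ∀ f' ∈ F, f ≠ f' → Disjoint (f • B) (f' • B)
  const_rnDeriv : ∀ f ∈ F, ∃ c : ℝ≥0∞,
    (compMeasure μ f).rnDeriv μ =ᵐ[μ.restrict B] fun _ => c

/-- The piece `{T_g x | g ∈ F f⁻¹}` (where `x ∈ T_f B`) of the orbit of `x` seen by the tower
`(B, F)`; it is empty if `x` is outside the tower. -/
def orbitPiece (B : Set X) (F : Finset G) (x : X) : Set X :=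
  {y | ∃ f ∈ F, x ∈ f • B ∧ ∃ h ∈ F, y = (h * f⁻¹) • x}

/-- The action is of rank one along `F 0 = {1} ⊆ F 1 ⊆ F 2 ⊆ ⋯`. -/
def IsRankOneAlong (μ : Measure X) (F : ℕ → Finset G) : Prop :=
  F 0 = {1} ∧ Monotone F ∧
  ∃ B : ℕ → Set X, Antitone B ∧ (∀ n, IsRokhlinTower μ (B n) (F n)) ∧
    -- every level of a tower is, mod `0`, a union of levels of the next tower
    (∀ n, ∀ f ∈ F n, ∃ S ⊆ F (n + 1), f • B n =ᵐ[μ] ⋃ h ∈ S, h • B (n + 1)) ∧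
    -- the towers exhaust the space and their levels separate points, mod `0`
    (∃ X₀ : Set X, (∀ᵐ x ∂μ, x ∈ X₀) ∧
      (∀ x ∈ X₀, ∃ n, ∃ f ∈ F n, x ∈ f • B n) ∧
      ∀ x ∈ X₀, ∀ y ∈ X₀, x ≠ y → ∃ n, ∃ f ∈ F n, x ∈ f • B n ∧ y ∉ f • B n) ∧
    -- the orbit pieces converge to the orbits
    (∀ᵐ x ∂μ, ∀ g : G, ∀ᶠ n in atTop, g • x ∈ orbitPiece (B n) (F n) x)

end Actions

/-! ### Continuous actions on locally compact spaces -/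

section TopologicalActions

/-- Nonempty zero-dimensional locally compact Polish spaces without isolated points. -/
structure IsLocallyCompactCantor (X : Type*) [TopologicalSpace X] : Prop where
  nonempty : Nonempty X
  t2 : T2Space X
  locallyCompact : LocallyCompactSpace X
  secondCountable : SecondCountableTopology X
  totallyDisconnected : TotallyDisconnectedSpace X
  perfect : PerfectSpace X

variable (G : Type*) [Group G] (X : Type*) [TopologicalSpace X] [MeasurableSpace X] [MulAction G X]

/-- Up to scaling, there is exactly one nonzero invariant Radon measure. -/
def IsRadonUniquelyErgodic : Prop :=
  ∃ ξ : Measure X, ξ ≠ 0 ∧ ξ.Regular ∧ SMulInvariantMeasure G X ξ ∧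
    ∀ ξ' : Measure X, ξ'.Regular → SMulInvariantMeasure G X ξ' → ∃ c : ℝ≥0, ξ' = c • ξ

variable {G X}

/-- A Borel cocycle of the action with values in the positive reals. -/
structure IsCocycle (ρ : G → X → ℝ≥0) : Prop where
  measurable : ∀ g, Measurable (ρ g)
  pos : ∀ g x, 0 < ρ g x
  mul : ∀ g₁ g₂ x, ρ g₂ (g₁ • x) * ρ g₁ x = ρ (g₂ * g₁) x

/-- `μ` is quasi-invariant and `d(μ ∘ T_g)/dμ = ρ g` for every `g`. -/
def HasRNCocycle (μ : Measure X) (ρ : G → X → ℝ≥0) : Prop :=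
  QuasiInvariant G μ ∧
    ∀ g : G, (compMeasure μ g).rnDeriv μ =ᵐ[μ] fun x => (ρ g x : ℝ≥0∞)

/-- Up to scaling, there is exactly one nonzero quasi-invariant Radon measure whose
Radon-Nikodym cocycle is `ρ`. -/
def IsRadonCocycleUniquelyErgodic (ρ : G → X → ℝ≥0) : Prop :=
  ∃ γ : Measure X, γ ≠ 0 ∧ γ.Regular ∧ HasRNCocycle γ ρ ∧
    ∀ γ' : Measure X, γ'.Regular → HasRNCocycle γ' ρ → ∃ c : ℝ≥0, γ' = c • γ

end TopologicalActions

/-! ### `(C,F)`-spaces, `(C,F)`-actions and `(C,F)`-measures -/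

/-- The sequences `(F n)`, `n ≥ 0`, and `(C n)`, `n ≥ 1`, of a `(C,F)`-construction
(`C 0` is not used). -/
structure CFShape (G : Type*) [Group G] where
  F : ℕ → Finset G
  C : ℕ → Finset G
  F_zero : F 0 = {1}
  one_mem_F : ∀ n, 1 ∈ F n
  one_mem_C : ∀ n, 1 ≤ n → 1 ∈ C n
  one_lt_card_C : ∀ n, 1 ≤ n → 1 < (C n).card
  mul_mem : ∀ n, ∀ f ∈ F n, ∀ c ∈ C (n + 1), f * c ∈ F (n + 1)
  disjoint : ∀ n, ∀ c ∈ C (n + 1), ∀ c' ∈ C (n + 1), c ≠ c' →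
    ∀ f ∈ F n, ∀ f' ∈ F n, f * c ≠ f' * c'

namespace CFShape

variable {G : Type*} [Group G] (S : CFShape G)

/-- `X_n = F_n × C_{n+1} × C_{n+2} × ⋯`. -/
abbrev Level (n : ℕ) : Type _ :=
  {f : G // f ∈ S.F n} × ((m : {m : ℕ // n < m}) → {c : G // c ∈ S.C m})

/-- The embedding `(f_n, c_{n+1}, c_{n+2}, …) ↦ (f_n c_{n+1}, c_{n+2}, …)` of `X_n` into
`X_{n+1}`. -/
def embed (n : ℕ) (x : S.Level n) : S.Level (n + 1) :=
  (⟨x.1 * x.2 ⟨n + 1, n.lt_succ_self⟩, S.mul_mem n _ x.1.2 _ (x.2 ⟨n + 1, n.lt_succ_self⟩).2⟩,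
    fun m => x.2 ⟨m, n.lt_succ_self.trans m.2⟩)

/-- The identifications that define the inductive limit. -/
inductive Glue : (Σ n, S.Level n) → (Σ n, S.Level n) → Prop
  | embed (n : ℕ) (x : S.Level n) : Glue ⟨n, x⟩ ⟨n + 1, S.embed n x⟩

/-- The `(C,F)`-space: the inductive limit of `X_0 → X_1 → X_2 → ⋯`. -/
def Space : Type _ := Quot S.Glue

/-- The canonical map of `X_n` into the inductive limit. -/
def point (n : ℕ) (x : S.Level n) : S.Space := Quot.mk _ ⟨n, x⟩

/-- The inductive limit topology (of the product topologies on the `X_n`). -/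
instance [TopologicalSpace G] : TopologicalSpace S.Space :=
  inferInstanceAs (TopologicalSpace (Quot S.Glue))

instance [TopologicalSpace G] : MeasurableSpace S.Space := borel _

instance [TopologicalSpace G] : BorelSpace S.Space := ⟨rfl⟩

/-- The cylinder `[f]_n`, the set of points `(f, c_{n+1}, c_{n+2}, …)` of `X_n`. -/
def cylinder (n : ℕ) (f : G) : Set S.Space :=
  {x | ∃ y : S.Level n, (y.1 : G) = f ∧ S.point n y = x}

/-- The set `F_n C_{n+1} C_{n+2} ⋯ C_{n+k}`. -/
def prodSet (n : ℕ) : ℕ → Set G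
  | 0 => S.F n
  | k + 1 => prodSet n k * (S.C (n + k + 1) : Set G)

/-- For each `g` and `n > 0` there is `m > n` with `g F_n C_{n+1} ⋯ C_m ⊆ F_m`. -/
def Absorbing : Prop :=
  ∀ g : G, ∀ n : ℕ, 0 < n → ∃ k : ℕ, 0 < k ∧ g • S.prodSet n k ⊆ (S.F (n + k) : Set G)

/-- The given action on the `(C,F)`-space is the `(C,F)`-action:
`T_g (f_n, c_{n+1}, …) = (g f_n, c_{n+1}, …)` whenever `f_n, g f_n ∈ F_n`. If `S` is absorbing
then every `g` and every point admit such an `n`, so this determines the action. -/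
def IsCFAction [MulAction G S.Space] : Prop :=
  ∀ (g : G) (n : ℕ) (x : S.Level n) (h : g * (x.1 : G) ∈ S.F n),
    g • S.point n x = S.point n (⟨g * x.1, h⟩, x.2)

end CFShape

/-- Nondegenerate probabilities `κ n` on `C n`, `n ≥ 1`, and nondegenerate finite measures `ν n` on
`F n`, `n ≥ 0`, given by their weights. Only the values of `κ n` on `C n` and of `ν n` on `F n`
are used. -/
structure CFWeights {G : Type*} [Group G] (S : CFShape G) where
  κ : ℕ → G → ℝ≥0
  ν : ℕ → G → ℝ≥0
  κ_pos : ∀ n, 1 ≤ n → ∀ c ∈ S.C n, 0 < κ n c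
  κ_sum : ∀ n, 1 ≤ n → ∑ c ∈ S.C n, κ n c = 1
  ν_pos : ∀ n, ∀ f ∈ S.F n, 0 < ν n f
  /-- `∏_{n > 0} max_{c ∈ C n} κ n c = 0`. -/
  prod_max : Tendsto (fun N : ℕ => ∏ n ∈ Finset.Icc 1 N, (S.C n).sup (κ n)) atTop (𝓝 0)
  ν_mul : ∀ n, ∀ f ∈ S.F n, ∀ c ∈ S.C (n + 1), ν (n + 1) (f * c) = ν n f * κ (n + 1) c

/-- `μ` is the `(C,F)`-measure determined by `κ` and `ν`, that is `μ [f]_n = ν_n (f)`. -/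
def CFWeights.IsCFMeasure {G : Type*} [Group G] [TopologicalSpace G] {S : CFShape G}
    (w : CFWeights S) (μ : Measure S.Space) : Prop :=
  ∀ n, ∀ f ∈ S.F n, μ (S.cylinder n f) = (w.ν n f : ℝ≥0∞)

end RankOne

end

/-!
A point of the `(C,F)`-space is a germ at infinity of a sequence `p` in `G` with
`p (k + 1) ∈ p k * C (k + 1)`, and `G` acts on germs by left multiplication. Within one level, the
cocycle prescribes the ratios of the masses of cylinders, and the masses of the cylinders contained
in a given one add up to its mass; hence a Radon measure with the given cocycle is determined up to
scaling.

For the realization, discard an invariant null set, so that the towers refine one another exactly.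
Call a level of a later tower a return to a base level if it is contained in it and its translates
by a given finite subset of `G` are again levels. In passing to a subsequence, each new base level
is chosen among the returns to the previous one, and the returns, which form the sets `C (n + 1)`,
fill the previous base level up to a proportion `2⁻ⁿ`. By Borel–Cantelli, almost every point lies in
returns from some stage on, and its positions in the towers form a germ; this is the isomorphism.
The derivatives are constant on levels, so the image measure is given by product weights.
-/

noncomputable section

namespace RankOne

namespace CFShape

variable {G : Type*} [Group G] (S : CFShape G)

lemma C_subset_F (n : ℕ) : S.C (n + 1) ⊆ S.F (n + 1) := fun c hc =>
  one_mul c ▸ S.mul_mem n 1 (S.one_mem_F n) c hc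

lemma prodSet_subset (n : ℕ) : ∀ k, S.prodSet n k ⊆ (S.F (n + k) : Set G)
  | 0 => Subset.rfl
  | k + 1 => by
    rintro _ ⟨a, ha, c, hc, rfl⟩
    exact S.mul_mem (n + k) a (prodSet_subset n k ha) c hc

/-! ### Points of a `(C,F)`-space as germs of sequences in the group -/

/-- The sequence of partial products `f_n c_{n+1} ⋯ c_k`, constant for `k ≤ n`. -/
def path (n : ℕ) (x : S.Level n) : ℕ → G
  | 0 => x.1
  | k + 1 => if h : n < k + 1 then path n x k * x.2 ⟨k + 1, h⟩ else x.1

/-- `p` is, from `n` on, the sequence of partial products of a point of `X_n`. -/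
structure IsPathFrom (n : ℕ) (p : ℕ → G) : Prop where
  mem : p n ∈ S.F n
  step : ∀ k, n ≤ k → (p k)⁻¹ * p (k + 1) ∈ S.C (k + 1)

variable {S}

lemma path_of_le {n : ℕ} (x : S.Level n) : ∀ {k : ℕ}, k ≤ n → S.path n x k = x.1
  | 0, _ => rfl
  | k + 1, h => by rw [path, dif_neg (by omega)]

lemma path_succ {n : ℕ} (x : S.Level n) {k : ℕ} (h : n ≤ k) :
    S.path n x (k + 1) = S.path n x k * x.2 ⟨k + 1, Nat.lt_succ_of_le h⟩ := by
  rw [path, dif_pos (Nat.lt_succ_of_le h)]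

lemma isPathFrom_path {n : ℕ} (x : S.Level n) : S.IsPathFrom n (S.path n x) where
  mem := by rw [path_of_le x le_rfl]; exact x.1.2
  step k hk := by rw [path_succ x hk, inv_mul_cancel_left]; exact (x.2 _).2

namespace IsPathFrom

variable {n : ℕ} {p q : ℕ → G}

lemma mem_of_le (h : S.IsPathFrom n p) {k : ℕ} (hk : n ≤ k) : p k ∈ S.F k := by
  induction k, hk using Nat.le_induction with
  | base => exact h.mem
  | succ k hk ih =>
    have := S.mul_mem k _ ih _ (h.step k hk)
    rwa [mul_inv_cancel_left] at this

lemma mono (h : S.IsPathFrom n p) {m : ℕ} (hm : n ≤ m) : S.IsPathFrom m p :=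
  ⟨h.mem_of_le hm, fun k hk => h.step k (hm.trans hk)⟩

lemma eq_of_succ (hp : S.IsPathFrom n p) (hq : S.IsPathFrom n q) {k : ℕ} (hk : n ≤ k)
    (h : p (k + 1) = q (k + 1)) : p k = q k := by
  by_contra hne
  by_cases hc : (p k)⁻¹ * p (k + 1) = (q k)⁻¹ * q (k + 1)
  · rw [h] at hc
    exact hne (inv_injective (mul_right_cancel hc))
  · refine S.disjoint k _ (hp.step k hk) _ (hq.step k hk) hc _ (hp.mem_of_le hk) _
      (hq.mem_of_le hk) ?_
    rw [mul_inv_cancel_left, mul_inv_cancel_left, h]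

lemma eq_of_eq (hp : S.IsPathFrom n p) (hq : S.IsPathFrom n q) {k N : ℕ} (hk : n ≤ k) (hN : k ≤ N)
    (h : p N = q N) : p k = q k := by
  induction N, hN using Nat.le_induction with
  | base => exact h
  | succ N hN ih => exact ih (hp.eq_of_succ hq (hk.trans hN) h)

lemma eq_of_eventuallyEq (hp : S.IsPathFrom n p) (hq : S.IsPathFrom n q) (h : p =ᶠ[atTop] q) {k : ℕ}
    (hk : n ≤ k) : p k = q k := by
  obtain ⟨N, h1, h2⟩ := (h.and (eventually_ge_atTop k)).exists
  exact hp.eq_of_eq hq hk h2 h1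

lemma glue (hp : S.IsPathFrom n p) {m N : ℕ} (hq : S.IsPathFrom m q) (hn : n ≤ N) (hm : m ≤ N)
    (h : p N = q N) : S.IsPathFrom n (fun k => if k ≤ N then p k else q k) where
  mem := by simpa [hn] using hp.mem
  step k hk := by
    rcases lt_trichotomy k N with hkN | rfl | hkN
    · simpa [hkN.le, Nat.succ_le_of_lt hkN] using hp.step k hk
    · simpa [h] using hq.step k hm
    · simpa [hkN.not_ge, show ¬ k + 1 ≤ N by omega] using hq.step k (hm.trans hkN.le)

/-- The point of `X_n` whose sequence of partial products is `p`. -/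
def toLevel (h : S.IsPathFrom n p) : S.Level n :=
  (⟨p n, h.mem⟩, fun m => ⟨(p (m.1 - 1))⁻¹ * p m, by
    obtain ⟨m, hm⟩ := m
    have := h.step (m - 1) (by omega)
    rwa [Nat.sub_add_cancel (by omega)] at this⟩)

lemma path_toLevel (h : S.IsPathFrom n p) {k : ℕ} (hk : n ≤ k) : S.path n h.toLevel k = p k := by
  induction k, hk using Nat.le_induction with
  | base => rw [path_of_le _ le_rfl]; rfl
  | succ k hk ih => rw [path_succ _ hk, ih]; simp [toLevel]

end IsPathFrom

lemma level_ext {n : ℕ} {x y : S.Level n} (h : ∀ k, n ≤ k → S.path n x k = S.path n y k) :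
    x = y := by
  refine Prod.ext (Subtype.ext ?_) (funext fun m => Subtype.ext ?_)
  · simpa [path_of_le] using h n le_rfl
  · obtain ⟨m, hm⟩ := m
    obtain ⟨k, rfl⟩ : ∃ k, m = k + 1 := ⟨m - 1, by omega⟩
    have hk : n ≤ k := by omega
    have := h (k + 1) (by omega)
    rw [path_succ x hk, path_succ y hk, h k hk] at this
    exact mul_left_cancel this

lemma path_embed {n : ℕ} (x : S.Level n) {k : ℕ} (hk : n + 1 ≤ k) :
    S.path (n + 1) (S.embed n x) k = S.path n x k := by
  induction k, hk using Nat.le_induction with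
  | base => rw [path_of_le _ le_rfl, path_succ x le_rfl, path_of_le x le_rfl]; rfl
  | succ k hk ih => rw [path_succ _ hk, path_succ x (by omega), ih]; rfl

variable (S) in
/-- The germ at infinity of the sequence of partial products of a point. -/
def germ : S.Space → Germ (atTop : Filter ℕ) G :=
  Quot.lift (fun x => (S.path x.1 x.2 : Germ atTop G)) (by
    rintro _ _ ⟨n, x⟩
    refine Germ.coe_eq.2 ?_
    filter_upwards [eventually_ge_atTop (n + 1)] with k hk using (path_embed x hk).symm)

lemma germ_point (n : ℕ) (x : S.Level n) : S.germ (S.point n x) = (S.path n x : Germ atTop G) :=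
  rfl

lemma point_embed (n : ℕ) (x : S.Level n) : S.point (n + 1) (S.embed n x) = S.point n x :=
  (Quot.sound (Glue.embed n x)).symm

lemma exists_point_eq_of_le {n m : ℕ} (h : n ≤ m) (x : S.Level n) :
    ∃ y : S.Level m, S.point m y = S.point n x := by
  induction m, h using Nat.le_induction with
  | base => exact ⟨x, rfl⟩
  | succ m _ ih =>
    obtain ⟨y, hy⟩ := ih
    exact ⟨S.embed m y, (point_embed m y).trans hy⟩

lemma exists_point (ξ : S.Space) : ∃ n x, S.point n x = ξ := by
  induction ξ using Quot.ind with
  | mk a => exact ⟨a.1, a.2, rfl⟩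

lemma germ_injective : Function.Injective S.germ := by
  intro ξ ζ h
  obtain ⟨n, x, rfl⟩ := exists_point ξ
  obtain ⟨m, y, rfl⟩ := exists_point ζ
  obtain ⟨x', hx⟩ := exists_point_eq_of_le (le_max_left n m) x
  obtain ⟨y', hy⟩ := exists_point_eq_of_le (le_max_right n m) y
  rw [← hx, ← hy] at h ⊢
  rw [germ_point, germ_point, Germ.coe_eq] at h
  congr 1
  exact level_ext fun k hk => (isPathFrom_path x').eq_of_eventuallyEq (isPathFrom_path y') h hk

lemma IsPathFrom.germ_point_toLevel {n : ℕ} {p : ℕ → G} (h : S.IsPathFrom n p) :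
    S.germ (S.point n h.toLevel) = (p : Germ atTop G) := by
  rw [germ_point, Germ.coe_eq]
  filter_upwards [eventually_ge_atTop n] with k hk using h.path_toLevel hk

lemma exists_isPathFrom (ξ : S.Space) :
    ∃ n p, S.IsPathFrom n p ∧ S.germ ξ = (p : Germ atTop G) := by
  obtain ⟨n, x, rfl⟩ := exists_point ξ
  exact ⟨n, _, isPathFrom_path x, rfl⟩

lemma IsPathFrom.exists_germ_eq {n : ℕ} {p : ℕ → G} (h : S.IsPathFrom n p) :
    ∃ ξ, S.germ ξ = (p : Germ atTop G) := ⟨_, h.germ_point_toLevel⟩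

/-! ### Cylinders -/

lemma mem_cylinder_iff {n : ℕ} {f : G} {ξ : S.Space} :
    ξ ∈ S.cylinder n f ↔ ∃ p, S.IsPathFrom n p ∧ p n = f ∧ S.germ ξ = (p : Germ atTop G) := by
  constructor
  · rintro ⟨y, rfl, rfl⟩
    exact ⟨_, isPathFrom_path y, path_of_le y le_rfl, rfl⟩
  · rintro ⟨p, hp, rfl, h⟩
    exact ⟨hp.toLevel, rfl, germ_injective (hp.germ_point_toLevel.trans h.symm)⟩

lemma IsPathFrom.mem_cylinder {n : ℕ} {p : ℕ → G} (h : S.IsPathFrom n p) {ξ : S.Space}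
    (hξ : S.germ ξ = (p : Germ atTop G)) {k : ℕ} (hk : n ≤ k) : ξ ∈ S.cylinder k (p k) :=
  mem_cylinder_iff.2 ⟨p, h.mono hk, rfl, hξ⟩

lemma IsPathFrom.eq_of_mem_cylinder {n : ℕ} {p : ℕ → G} (h : S.IsPathFrom n p) {ξ : S.Space}
    (hξ : S.germ ξ = (p : Germ atTop G)) {k : ℕ} (hk : n ≤ k) {f : G}
    (hf : ξ ∈ S.cylinder k f) : f = p k := by
  obtain ⟨q, hq, rfl, h'⟩ := mem_cylinder_iff.1 hf
  rw [hξ, Germ.coe_eq] at h'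
  exact ((h.mono hk).eq_of_eventuallyEq hq h' le_rfl).symm

lemma eq_of_mem_cylinder {n : ℕ} {f f' : G} {ξ : S.Space} (h : ξ ∈ S.cylinder n f)
    (h' : ξ ∈ S.cylinder n f') : f = f' := by
  obtain ⟨p, hp, rfl, hξ⟩ := mem_cylinder_iff.1 h
  exact (hp.eq_of_mem_cylinder hξ le_rfl h').symm

lemma disjoint_cylinder {n : ℕ} {f f' : G} (h : f ≠ f') :
    Disjoint (S.cylinder n f) (S.cylinder n f') :=
  Set.disjoint_left.2 fun _ h1 h2 => h (eq_of_mem_cylinder h1 h2)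

lemma eventually_mem_cylinder (ξ : S.Space) : ∀ᶠ n in atTop, ∃ f ∈ S.F n, ξ ∈ S.cylinder n f := by
  obtain ⟨n, p, hp, hξ⟩ := exists_isPathFrom ξ
  filter_upwards [eventually_ge_atTop n] with k hk
  exact ⟨p k, hp.mem_of_le hk, hp.mem_cylinder hξ hk⟩

lemma frequently_mem_cylinder_ne {ξ ζ : S.Space} (h : ξ ≠ ζ) :
    ∃ᶠ n in atTop, ∃ f f', f ≠ f' ∧ ξ ∈ S.cylinder n f ∧ ζ ∈ S.cylinder n f' := by
  obtain ⟨n, p, hp, hξ⟩ := exists_isPathFrom ξ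
  obtain ⟨m, q, hq, hζ⟩ := exists_isPathFrom ζ
  have hpq : ∃ᶠ k in atTop, p k ≠ q k := fun he =>
    h (germ_injective (by rw [hξ, hζ, Germ.coe_eq]; simpa [EventuallyEq] using he))
  refine (hpq.and_eventually ((eventually_ge_atTop n).and (eventually_ge_atTop m))).mono ?_
  exact fun k hk => ⟨_, _, hk.1, hp.mem_cylinder hξ hk.2.1, hq.mem_cylinder hζ hk.2.2⟩

lemma subsingleton_iInter_cylinder {n : ℕ} (p : ℕ → G) :
    (⋂ k ≥ n, S.cylinder k (p k)).Subsingleton := by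
  intro ξ hξ ζ hζ
  by_contra hne
  obtain ⟨k, ⟨f, f', hff', hf, hf'⟩, hk⟩ :=
    ((frequently_mem_cylinder_ne hne).and_eventually (eventually_ge_atTop n)).exists
  exact hff' ((eq_of_mem_cylinder hf (mem_iInter₂.1 hξ k hk)).trans
    (eq_of_mem_cylinder (mem_iInter₂.1 hζ k hk) hf'))

lemma IsPathFrom.cylinder_subset {n : ℕ} {p : ℕ → G} (h : S.IsPathFrom n p) {k : ℕ}
    (hk : n ≤ k) : S.cylinder k (p k) ⊆ S.cylinder n (p n) := by
  intro ξ hξ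
  obtain ⟨q, hq, h1, h2⟩ := mem_cylinder_iff.1 hξ
  refine mem_cylinder_iff.2 ⟨_, h.glue hq hk le_rfl h1.symm, by simp [hk], ?_⟩
  rw [h2, Germ.coe_eq]
  filter_upwards [eventually_gt_atTop k] with j hj
  rw [if_neg (by omega)]

lemma cylinder_subset_of_mem {n m : ℕ} {f f' : G} {ξ : S.Space} (hnm : n ≤ m)
    (h : ξ ∈ S.cylinder n f) (h' : ξ ∈ S.cylinder m f') : S.cylinder m f' ⊆ S.cylinder n f := by
  obtain ⟨p, hp, rfl, hξ⟩ := mem_cylinder_iff.1 h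
  rw [hp.eq_of_mem_cylinder hξ hnm h']
  exact hp.cylinder_subset hnm

lemma isPathFrom_const {n : ℕ} {f : G} (h : f ∈ S.F n) : S.IsPathFrom n (fun _ => f) :=
  ⟨h, fun k _ => by simpa using S.one_mem_C (k + 1) (by omega)⟩

lemma cylinder_nonempty {n : ℕ} {f : G} (h : f ∈ S.F n) : (S.cylinder n f).Nonempty := by
  obtain ⟨ξ, hξ⟩ := (isPathFrom_const h).exists_germ_eq
  exact ⟨ξ, (isPathFrom_const h).mem_cylinder hξ le_rfl⟩

lemma cylinder_mul_subset {n : ℕ} {f c : G} (hf : f ∈ S.F n) (hc : c ∈ S.C (n + 1)) :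
    S.cylinder (n + 1) (f * c) ⊆ S.cylinder n f := by
  have hp : S.IsPathFrom n fun k => if k ≤ n then f else f * c := by
    refine ⟨by simpa using hf, fun k hk => ?_⟩
    rcases hk.eq_or_lt with rfl | hk
    · simpa using hc
    · simpa [hk.not_ge, show ¬ k + 1 ≤ n by omega] using S.one_mem_C (k + 1) (by omega)
  simpa using hp.cylinder_subset n.le_succ

lemma cylinder_eq_iUnion {n : ℕ} {f : G} (h : f ∈ S.F n) :
    S.cylinder n f = ⋃ c ∈ S.C (n + 1), S.cylinder (n + 1) (f * c) := by
  refine Subset.antisymm (fun ξ hξ => ?_) (iUnion₂_subset fun c => cylinder_mul_subset h)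
  obtain ⟨p, hp, rfl, hg⟩ := mem_cylinder_iff.1 hξ
  refine mem_iUnion₂.2 ⟨_, hp.step n le_rfl, ?_⟩
  rw [mul_inv_cancel_left]
  exact hp.mem_cylinder hg n.le_succ

lemma range_point (n : ℕ) : Set.range (S.point n) = ⋃ f ∈ S.F n, S.cylinder n f := by
  ext ξ
  simp only [mem_range, mem_iUnion, exists_prop]
  constructor
  · rintro ⟨y, rfl⟩
    exact ⟨y.1, y.1.2, y, rfl, rfl⟩
  · rintro ⟨f, -, y, -, rfl⟩
    exact ⟨y, rfl⟩

lemma range_point_zero : Set.range (S.point 0) = S.cylinder 0 1 := by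
  simp [range_point, S.F_zero]

lemma countable_setOf_cylinder [Countable G] (P : ℕ → G → Prop) :
    {U : Set S.Space | ∃ n f, P n f ∧ U = S.cylinder n f}.Countable := by
  refine (countable_range fun a : ℕ × G => S.cylinder a.1 a.2).mono ?_
  rintro _ ⟨n, f, -, rfl⟩
  exact ⟨(n, f), rfl⟩

lemma point_mem_cylinder_iff {n k : ℕ} (hk : n ≤ k) {x : S.Level n} {f : G} :
    S.point n x ∈ S.cylinder k f ↔ S.path n x k = f := by
  refine ⟨fun h => ((isPathFrom_path x).eq_of_mem_cylinder rfl hk h).symm, ?_⟩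
  rintro rfl
  exact (isPathFrom_path x).mem_cylinder rfl hk

/-! ### The topology of a `(C,F)`-space -/

section Topology

variable [TopologicalSpace G]

lemma continuous_point (n : ℕ) : Continuous (S.point n) :=
  continuous_quot_mk.comp continuous_sigmaMk

lemma isOpen_iff {U : Set S.Space} : IsOpen U ↔ ∀ n, IsOpen (S.point n ⁻¹' U) :=
  ⟨fun h n => h.preimage (continuous_point n),
    fun h => isOpen_coinduced.2 (isOpen_sigma_iff.2 h)⟩

variable [DiscreteTopology G]

lemma continuous_path (n k : ℕ) : Continuous fun x : S.Level n => S.path n x k := by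
  induction k with
  | zero => exact continuous_subtype_val.comp continuous_fst
  | succ k ih =>
    by_cases h : n < k + 1
    · simp only [path, dif_pos h]
      exact ih.mul (continuous_subtype_val.comp ((continuous_apply _).comp continuous_snd))
    · simp only [path, dif_neg h]
      exact continuous_subtype_val.comp continuous_fst

lemma isOpen_cylinder (n : ℕ) (f : G) : IsOpen (S.cylinder n f) := by
  refine isOpen_iff.2 fun m => isOpen_iff_mem_nhds.2 fun x hx => ?_
  obtain ⟨q, hq, rfl, h⟩ := mem_cylinder_iff.1 hx
  set N := max m n
  have hN : S.path m x N = q N := ((isPathFrom_path x).mono (le_max_left m n)).eq_of_eventuallyEq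
    (hq.mono (le_max_right m n)) (Germ.coe_eq.1 h) le_rfl
  have ho : IsOpen {y : S.Level m | S.path m y N = q N} :=
    (isOpen_discrete {q N}).preimage (continuous_path m N)
  filter_upwards [ho.mem_nhds hN] with y hy
  apply hq.cylinder_subset (le_max_right m n)
  rw [← show S.path m y N = q N from hy]
  exact (isPathFrom_path y).mem_cylinder rfl (le_max_left m n)

lemma isCompact_cylinder (n : ℕ) (f : G) : IsCompact (S.cylinder n f) :=
  (((isClosed_discrete {f}).preimage
    (continuous_subtype_val.comp continuous_fst)).isCompact.image (continuous_point n) :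
    IsCompact (S.point n '' {y | (y.1 : G) = f}))

instance : T2Space S.Space := by
  refine ⟨fun ξ ζ hne => ?_⟩
  obtain ⟨n, f, f', hff', hξ, hζ⟩ := (frequently_mem_cylinder_ne hne).exists
  exact ⟨_, _, isOpen_cylinder n f, isOpen_cylinder n f', hξ, hζ, disjoint_cylinder hff'⟩

lemma isClopen_cylinder (n : ℕ) (f : G) : IsClopen (S.cylinder n f) :=
  ⟨(isCompact_cylinder n f).isClosed, isOpen_cylinder n f⟩

lemma eventually_cylinder_subset {U : Set S.Space} {ξ : S.Space} (hU : U ∈ 𝓝 ξ) :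
    ∀ᶠ n in atTop, ∀ f, ξ ∈ S.cylinder n f → S.cylinder n f ⊆ U := by
  obtain ⟨n, p, hp, hξ⟩ := exists_isPathFrom ξ
  have hanti : Antitone fun k => S.cylinder (n + k) (p (n + k)) := fun k m hkm =>
    (hp.mono (n.le_add_right k)).cylinder_subset (Nat.add_le_add_left hkm n)
  have hmem : ∀ {k}, n ≤ k → ξ ∈ S.cylinder k (p k) := hp.mem_cylinder hξ
  obtain ⟨k, hk⟩ : ∃ k, S.cylinder (n + k) (p (n + k)) ⊆ U := by
    refine exists_subset_nhds_of_isCompact hanti.directed_ge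
      (fun k => isCompact_cylinder _ _) fun ζ hζ => ?_
    obtain rfl : ζ = ξ := by
      refine subsingleton_iInter_cylinder (n := n) p (mem_iInter₂.2 fun k hk => ?_)
        (mem_iInter₂.2 fun k => hmem)
      simpa [Nat.add_sub_cancel' hk] using mem_iInter.1 hζ (k - n)
    exact hU
  filter_upwards [eventually_ge_atTop (n + k)] with m hm f hf
  exact (cylinder_subset_of_mem hm (hmem (n.le_add_right k)) hf).trans hk

lemma isTopologicalBasis_cylinder {P : ℕ → G → Prop}
    (hP : ∀ ξ, ∀ᶠ n in atTop, ∃ f, P n f ∧ ξ ∈ S.cylinder n f) :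
    TopologicalSpace.IsTopologicalBasis {U : Set S.Space | ∃ n f, P n f ∧ U = S.cylinder n f} := by
  refine TopologicalSpace.isTopologicalBasis_of_isOpen_of_nhds ?_ fun ξ U h hU => ?_
  · rintro _ ⟨n, f, -, rfl⟩
    exact isOpen_cylinder n f
  · obtain ⟨n, ⟨f, hf, hξ⟩, hsub⟩ :=
      ((hP ξ).and (eventually_cylinder_subset (hU.mem_nhds h))).exists
    exact ⟨_, ⟨n, f, hf, rfl⟩, hξ, hsub f hξ⟩

instance : LocallyCompactSpace S.Space :=
  have : WeaklyLocallyCompactSpace S.Space := ⟨fun ξ => by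
    obtain ⟨n, f, -, hf⟩ := (eventually_mem_cylinder ξ).exists
    exact ⟨_, isCompact_cylinder n f, (isOpen_cylinder n f).mem_nhds hf⟩⟩
  inferInstance

instance [Countable G] : SecondCountableTopology S.Space :=
  (isTopologicalBasis_cylinder eventually_mem_cylinder).secondCountableTopology
    (countable_setOf_cylinder _)

instance : TotallyDisconnectedSpace S.Space :=
  have : TotallySeparatedSpace S.Space :=
    totallySeparatedSpace_iff_exists_isClopen.2 fun ξ ζ hne => by
      obtain ⟨n, f, f', hff', hξ, hζ⟩ := (frequently_mem_cylinder_ne hne).exists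
      exact ⟨_, isClopen_cylinder n f, hξ, (disjoint_cylinder hff').notMem_of_mem_right hζ⟩
  inferInstance

instance : PerfectSpace S.Space := by
  refine perfectSpace_iff_forall_not_isolated.2 fun ξ => ?_
  rw [← mem_closure_iff_nhdsWithin_neBot, mem_closure_iff]
  intro U hU hξ
  obtain ⟨n, ⟨f, hf, hfξ⟩, hsub⟩ :=
    ((eventually_mem_cylinder ξ).and (eventually_cylinder_subset (hU.mem_nhds hξ))).exists
  obtain ⟨c, hc, hcξ⟩ : ∃ c ∈ S.C (n + 1), ξ ∉ S.cylinder (n + 1) (f * c) := by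
    by_contra! h
    obtain ⟨c, hc, c', hc', hne⟩ := Finset.one_lt_card.1 (S.one_lt_card_C (n + 1) (by omega))
    exact hne (mul_left_cancel (eq_of_mem_cylinder (h c hc) (h c' hc')))
  obtain ⟨ζ, hζ⟩ := cylinder_nonempty (S.mul_mem n f hf c hc)
  exact ⟨ζ, hsub f hfξ (cylinder_mul_subset hf hc hζ), fun h => hcξ (h ▸ hζ)⟩

variable (S) in
theorem isLocallyCompactCantor [Countable G] : IsLocallyCompactCantor S.Space where
  nonempty := (cylinder_nonempty (S.one_mem_F 0)).to_type
  t2 := inferInstance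
  locallyCompact := inferInstance
  secondCountable := inferInstance
  totallyDisconnected := inferInstance
  perfect := inferInstance

end Topology

/-! ### The `(C,F)`-action -/

lemma path_translate {n : ℕ} (g : G) (x : S.Level n) (h : g * (x.1 : G) ∈ S.F n) {k : ℕ}
    (hk : n ≤ k) : S.path n (⟨g * x.1, h⟩, x.2) k = g * S.path n x k := by
  induction k, hk using Nat.le_induction with
  | base => rw [path_of_le _ le_rfl, path_of_le _ le_rfl]
  | succ k hk ih => rw [path_succ _ hk, path_succ _ hk, ih, mul_assoc]

lemma germ_translate {n : ℕ} (g : G) (x : S.Level n) (h : g * (x.1 : G) ∈ S.F n) :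
    S.germ (S.point n (⟨g * x.1, h⟩, x.2)) = g • S.germ (S.point n x) := by
  rw [germ_point, germ_point, ← Germ.coe_smul, Germ.coe_eq]
  filter_upwards [eventually_ge_atTop n] with k hk using path_translate g x h hk

namespace IsPathFrom

variable {n : ℕ} {p : ℕ → G}

lemma mem_prodSet (h : S.IsPathFrom n p) (k : ℕ) : p (n + k) ∈ S.prodSet n k := by
  induction k with
  | zero => exact h.mem
  | succ k ih =>
    exact Set.mem_mul.2 ⟨_, ih, _, h.step (n + k) (by omega), mul_inv_cancel_left _ _⟩

lemma const_mul (h : S.IsPathFrom n p) {g : G} (hg : g * p n ∈ S.F n) :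
    S.IsPathFrom n (fun k => g * p k) :=
  ⟨hg, fun k hk => by simpa [mul_assoc] using h.step k hk⟩

lemma eventually_mul_mem (h : S.IsPathFrom n p) (hA : S.Absorbing) (g : G) :
    ∀ᶠ k in atTop, g * p k ∈ S.F k := by
  obtain ⟨k, -, hk⟩ := hA g (n + 1) n.succ_pos
  have hp := h.mono n.le_succ
  have hm : g * p (n + 1 + k) ∈ S.F (n + 1 + k) :=
    hk (Set.smul_mem_smul_set (hp.mem_prodSet k))
  filter_upwards [eventually_ge_atTop (n + 1 + k)] with j hj
  exact ((hp.mono (Nat.le_add_right _ k)).const_mul hm).mem_of_le hj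

end IsPathFrom

namespace Absorbing

lemma exists_germ_eq_smul (hA : S.Absorbing) (g : G) (ξ : S.Space) :
    ∃ ζ, S.germ ζ = g • S.germ ξ := by
  obtain ⟨n, p, hp, hξ⟩ := exists_isPathFrom ξ
  obtain ⟨k, hk, hkn⟩ := ((hp.eventually_mul_mem hA g).and (eventually_ge_atTop n)).exists
  rw [hξ]
  exact ((hp.mono hkn).const_mul hk).exists_germ_eq

/-- The `(C,F)`-action: on germs of sequences in `G` it is the left multiplication. -/
@[reducible]
def mulAction (hA : S.Absorbing) : MulAction G S.Space :=
  letI : SMul G S.Space := ⟨fun g ξ => (hA.exists_germ_eq_smul g ξ).choose⟩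
  Function.Injective.mulAction S.germ germ_injective
    fun g ξ => (hA.exists_germ_eq_smul g ξ).choose_spec

lemma isCFAction (hA : S.Absorbing) :
    letI := hA.mulAction
    S.IsCFAction := by
  let := hA.mulAction
  intro g n x h
  apply germ_injective
  rw [germ_translate]
  exact (hA.exists_germ_eq_smul g _).choose_spec

lemma eventually_mem_cylinder (hA : S.Absorbing) (g : G) (ξ : S.Space) :
    ∀ᶠ n in atTop, ∃ f, (f ∈ S.F n ∧ g * f ∈ S.F n) ∧ ξ ∈ S.cylinder n f := by
  obtain ⟨n, p, hp, hξ⟩ := exists_isPathFrom ξ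
  filter_upwards [hp.eventually_mul_mem hA g, eventually_ge_atTop n] with k hk hkn
  exact ⟨p k, ⟨hp.mem_of_le hkn, hk⟩, hp.mem_cylinder hξ hkn⟩

end Absorbing

namespace IsCFAction

variable [MulAction G S.Space]

lemma smul_mem_cylinder (hG : S.IsCFAction) {g : G} {n : ℕ} {f : G} (hf : g * f ∈ S.F n)
    {ξ : S.Space} (h : ξ ∈ S.cylinder n f) : g • ξ ∈ S.cylinder n (g * f) := by
  obtain ⟨y, rfl, rfl⟩ := h
  rw [hG g n y hf]
  exact ⟨_, rfl, rfl⟩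

lemma smul_cylinder (hG : S.IsCFAction) {g : G} {n : ℕ} {f : G} (hf : f ∈ S.F n)
    (hgf : g * f ∈ S.F n) : g • S.cylinder n f = S.cylinder n (g * f) := by
  refine Subset.antisymm ?_ fun ξ hξ => Set.mem_smul_set_iff_inv_smul_mem.2 ?_
  · rintro _ ⟨ξ, hξ, rfl⟩
    exact hG.smul_mem_cylinder hgf hξ
  · simpa using hG.smul_mem_cylinder (g := g⁻¹) (by rwa [inv_mul_cancel_left]) hξ

lemma germ_smul (hG : S.IsCFAction) (hA : S.Absorbing) (g : G) (ξ : S.Space) :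
    S.germ (g • ξ) = g • S.germ ξ := by
  obtain ⟨n, f, ⟨-, hgf⟩, y, rfl, rfl⟩ := (hA.eventually_mem_cylinder g ξ).exists
  rw [hG g n y hgf, germ_translate]

lemma smul_ne (hG : S.IsCFAction) (hA : S.Absorbing) {g : G} (hg : g ≠ 1) (ξ : S.Space) :
    g • ξ ≠ ξ := by
  intro h
  obtain ⟨n, f, ⟨-, hgf⟩, hξ⟩ := (hA.eventually_mem_cylinder g ξ).exists
  exact hg (mul_eq_right.1 (eq_of_mem_cylinder (h ▸ hG.smul_mem_cylinder hgf hξ) hξ))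

variable [TopologicalSpace G] [DiscreteTopology G]

lemma continuousConstSMul (hG : S.IsCFAction) (hA : S.Absorbing) :
    ContinuousConstSMul G S.Space := by
  refine ⟨fun g => continuous_iff_continuousAt.2 fun ξ U hU => ?_⟩
  obtain ⟨n, ⟨f, ⟨-, hgf⟩, hξ⟩, hsub⟩ :=
    ((hA.eventually_mem_cylinder g ξ).and (eventually_cylinder_subset hU)).exists
  refine Filter.mem_map.2 ?_
  filter_upwards [(isOpen_cylinder n f).mem_nhds hξ] with ζ hζ
  exact hsub _ (hG.smul_mem_cylinder hgf hξ) (hG.smul_mem_cylinder hgf hζ)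

lemma isMinimal (hG : S.IsCFAction) : MulAction.IsMinimal G S.Space := by
  refine ⟨fun ξ => (isTopologicalBasis_cylinder CFShape.eventually_mem_cylinder).dense_iff.2 ?_⟩
  rintro _ ⟨n, f, hf, rfl⟩ -
  obtain ⟨k, ⟨f', -, hξ⟩, hnk⟩ :=
    ((CFShape.eventually_mem_cylinder ξ).and (eventually_ge_atTop n)).exists
  have h := hG.smul_mem_cylinder (g := f * f'⁻¹)
    (by rw [inv_mul_cancel_right]; exact (isPathFrom_const hf).mem_of_le hnk) hξ
  rw [inv_mul_cancel_right] at h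
  exact ⟨_, (isPathFrom_const hf).cylinder_subset hnk h, mem_range_self _⟩

end IsCFAction

end CFShape

/-! ### Radon-Nikodym cocycles -/

section RadonNikodym

variable {G : Type*} [Group G] {X : Type*} [MeasurableSpace X] [MulAction G X]
  [MeasurableConstSMul G X]

lemma compMeasure_apply (μ : Measure X) (g : G) (s : Set X) : compMeasure μ g s = μ (g • s) := by
  rw [← Set.preimage_smul_inv]
  exact (MeasurableEquiv.smul g⁻¹).map_apply s

lemma hasRNCocycle_iff_compMeasure_eq {μ : Measure X} [SigmaFinite μ] {ρ : G → X → ℝ≥0}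
    (hρ : ∀ g, Measurable (ρ g)) :
    HasRNCocycle μ ρ ↔ ∀ g, compMeasure μ g = μ.withDensity fun x => (ρ g x : ℝ≥0∞) := by
  refine ⟨fun h g => ?_, fun h => ⟨fun g => ⟨measurable_const_smul g, ?_⟩, fun g => ?_⟩⟩
  · have : SigmaFinite (compMeasure μ g) := (MeasurableEquiv.smul g⁻¹).sigmaFinite_map
    rw [← withDensity_congr_ae (h.2 g)]
    exact (Measure.withDensity_rnDeriv_eq _ _ (h.1 g⁻¹).absolutelyContinuous).symm
  · have hg : μ.map (fun x => g • x) = μ.withDensity fun x => (ρ g⁻¹ x : ℝ≥0∞) := by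
      simpa [compMeasure] using h g⁻¹
    exact hg ▸ withDensity_absolutelyContinuous _ _
  · rw [h g]
    exact Measure.rnDeriv_withDensity _ (hρ g).coe_nnreal_ennreal

lemma hasRNCocycle_one_iff {μ : Measure X} [SigmaFinite μ] :
    HasRNCocycle μ (1 : G → X → ℝ≥0) ↔ SMulInvariantMeasure G X μ := by
  rw [hasRNCocycle_iff_compMeasure_eq (ρ := 1) fun _ => measurable_one,
    (smulInvariantMeasure_tfae G μ).out 0 5 rfl rfl]
  refine inv_surjective.forall.trans (forall_congr' fun g => ?_)
  simp [compMeasure]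

end RadonNikodym

lemma IsRadonUniquelyErgodic.existsUnique_measure_eq_one {G : Type*} [Group G] {X : Type*}
    [TopologicalSpace X] [MeasurableSpace X] [MulAction G X] [ContinuousConstSMul G X]
    [MulAction.IsMinimal G X] (h : IsRadonUniquelyErgodic G X)
    {K : Set X} (hK : IsCompact K) (hKo : IsOpen K) (hne : K.Nonempty) :
    ∃! ξ : Measure X, ξ.Regular ∧ SMulInvariantMeasure G X ξ ∧ ξ K = 1 := by
  obtain ⟨γ, hγ0, hγ, hinv, hγuniq⟩ := h
  have hpos : γ K ≠ 0 := (measure_isOpen_pos_of_smulInvariant_of_ne_zero G hγ0 hKo hne).ne'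
  have hfin : γ K ≠ ∞ := hK.measure_lt_top.ne
  refine ⟨(γ K).toNNReal⁻¹ • γ, ⟨inferInstance, inferInstance, ?_⟩, ?_⟩
  · rw [Measure.smul_apply, ENNReal.smul_def, smul_eq_mul, ENNReal.coe_inv
      (ENNReal.toNNReal_ne_zero.2 ⟨hpos, hfin⟩), ENNReal.coe_toNNReal hfin,
      ENNReal.inv_mul_cancel hpos hfin]
  · rintro ξ ⟨hξ, hξinv, hξK⟩
    obtain ⟨c, rfl⟩ := hγuniq ξ hξ hξinv
    congr 1
    refine eq_inv_of_mul_eq_one_left ?_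
    simpa using congrArg ENNReal.toNNReal hξK

namespace CFShape

variable {G : Type*} [Group G] {S : CFShape G} [TopologicalSpace G] [DiscreteTopology G]

/-! ### Measures on a `(C,F)`-space -/

lemma measurableSet_cylinder (n : ℕ) (f : G) : MeasurableSet (S.cylinder n f) :=
  (isOpen_cylinder n f).measurableSet

lemma measure_cylinder_lt_top (μ : Measure S.Space) [IsFiniteMeasureOnCompacts μ] (n : ℕ)
    (f : G) : μ (S.cylinder n f) < ∞ :=
  (isCompact_cylinder n f).measure_lt_top

lemma measure_cylinder_eq_sum (μ : Measure S.Space) {n : ℕ} {f : G} (hf : f ∈ S.F n) :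
    μ (S.cylinder n f) = ∑ c ∈ S.C (n + 1), μ (S.cylinder (n + 1) (f * c)) := by
  rw [cylinder_eq_iUnion hf, measure_biUnion_finset]
  · intro c _ c' _ hne
    exact disjoint_cylinder fun h => hne (mul_left_cancel h)
  · exact fun c _ => measurableSet_cylinder _ _

lemma IsCFAction.compMeasure_cylinder [MulAction G S.Space] (hG : S.IsCFAction)
    (hA : S.Absorbing) (μ : Measure S.Space) {g : G} {n : ℕ} {f : G} (hf : f ∈ S.F n)
    (hgf : g * f ∈ S.F n) : compMeasure μ g (S.cylinder n f) = μ (S.cylinder n (g * f)) := by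
  have := hG.continuousConstSMul hA
  rw [compMeasure_apply, hG.smul_cylinder hf hgf]

variable [Countable G]

lemma measure_ext {P : ℕ → G → Prop}
    (hP : ∀ ξ, ∀ᶠ n in atTop, ∃ f, P n f ∧ ξ ∈ S.cylinder n f) {μ ν : Measure S.Space}
    (hfin : ∀ n f, P n f → μ (S.cylinder n f) ≠ ∞)
    (h : ∀ n f, P n f → μ (S.cylinder n f) = ν (S.cylinder n f)) : μ = ν := by
  refine Measure.ext_of_generateFrom_of_cover_subset
    (isTopologicalBasis_cylinder hP).borel_eq_generateFrom ?_ Subset.rfl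
    (countable_setOf_cylinder P) ?_ ?_ ?_
  · rintro _ ⟨n, f, hf, rfl⟩ _ ⟨m, f', hf', rfl⟩ ⟨ξ, h1, h2⟩
    rcases le_total n m with hnm | hnm
    · exact ⟨m, f', hf', inter_eq_right.2 (cylinder_subset_of_mem hnm h1 h2)⟩
    · exact ⟨n, f, hf, inter_eq_left.2 (cylinder_subset_of_mem hnm h2 h1)⟩
  · refine eq_univ_of_forall fun ξ => ?_
    obtain ⟨n, f, hf, hξ⟩ := (hP ξ).exists
    exact ⟨_, ⟨n, f, hf, rfl⟩, hξ⟩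
  · rintro _ ⟨n, f, hf, rfl⟩
    exact hfin n f hf
  · rintro _ ⟨n, f, hf, rfl⟩
    exact h n f hf

lemma eq_smul_of_measure_cylinder_eq {μ γ : Measure S.Space} [IsFiniteMeasureOnCompacts μ]
    (h0 : ∀ n, μ (S.cylinder n 1) ≠ 0) {t : ℕ → ℝ≥0}
    (h : ∀ n, ∀ f ∈ S.F n, γ (S.cylinder n f) = t n * μ (S.cylinder n f)) : γ = t 0 • μ := by
  have hstep : ∀ n, t (n + 1) = t n := fun n => by
    have h1 := S.one_mem_F n
    have : (t (n + 1) : ℝ≥0∞) * μ (S.cylinder n 1) = t n * μ (S.cylinder n 1) := by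
      rw [← h n 1 h1, measure_cylinder_eq_sum μ h1, measure_cylinder_eq_sum γ h1, Finset.mul_sum]
      exact Finset.sum_congr rfl fun c hc => (h _ _ (S.mul_mem n 1 h1 c hc)).symm
    exact ENNReal.coe_injective
      ((ENNReal.mul_left_inj (h0 n) (measure_cylinder_lt_top μ n 1).ne).1 this)
  have ht : ∀ n, t n = t 0 := fun n => by
    induction n with
    | zero => rfl
    | succ n ih => rw [hstep, ih]
  refine (measure_ext (P := fun n f => f ∈ S.F n) eventually_mem_cylinder
    (fun n f _ => (measure_cylinder_lt_top (t 0 • μ) n f).ne) fun n f hf => ?_).symm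
  rw [h n f hf, ht n]
  rfl

end CFShape

open CFShape

namespace CFWeights

variable {G : Type*} [Group G] {S : CFShape G} (w : CFWeights S)

/-! ### The cocycle of a `(C,F)`-measure -/

open Classical in
/-- The derivative `d(μ ∘ T_g)/dμ` of the `(C,F)`-measure `μ`: it is `ν_n (g f) / ν_n (f)` on
`[f]_n` whenever `f, g f ∈ F_n`. -/
def cocycle (g : G) (ξ : S.Space) : ℝ≥0 :=
  if h : ∃ a : ℕ × G, g * a.2 ∈ S.F a.1 ∧ ξ ∈ S.cylinder a.1 a.2 then
    w.ν h.choose.1 (g * h.choose.2) / w.ν h.choose.1 h.choose.2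
  else 1

lemma ν_eq_mul_prod {n : ℕ} {p : ℕ → G} (hp : S.IsPathFrom n p) {k : ℕ} (hk : n ≤ k) :
    w.ν k (p k) = w.ν n (p n) * ∏ m ∈ Finset.Ioc n k, w.κ m ((p (m - 1))⁻¹ * p m) := by
  induction k, hk using Nat.le_induction with
  | base => simp
  | succ k hk ih =>
    have := w.ν_mul k _ (hp.mem_of_le hk) _ (hp.step k hk)
    rw [Finset.prod_Ioc_succ_top hk, ← mul_assoc, ← ih]
    simpa using this

lemma ν_div_eq {n : ℕ} {p : ℕ → G} (hp : S.IsPathFrom n p) {g : G} (hg : g * p n ∈ S.F n) {k : ℕ}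
    (hk : n ≤ k) : w.ν k (g * p k) / w.ν k (p k) = w.ν n (g * p n) / w.ν n (p n) := by
  have hκ : ∏ m ∈ Finset.Ioc n k, w.κ m ((p (m - 1))⁻¹ * p m) ≠ 0 :=
    right_ne_zero_of_mul (w.ν_eq_mul_prod hp hk ▸ (w.ν_pos k _ (hp.mem_of_le hk)).ne')
  rw [w.ν_eq_mul_prod hp hk, w.ν_eq_mul_prod (hp.const_mul hg) hk]
  simp only [mul_inv_rev, mul_assoc, inv_mul_cancel_left]
  exact mul_div_mul_right _ _ hκ

lemma cocycle_eq {g : G} {n : ℕ} {f : G} (hgf : g * f ∈ S.F n) {ξ : S.Space}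
    (hξ : ξ ∈ S.cylinder n f) : w.cocycle g ξ = w.ν n (g * f) / w.ν n f := by
  have hex : ∃ a : ℕ × G, g * a.2 ∈ S.F a.1 ∧ ξ ∈ S.cylinder a.1 a.2 := ⟨(n, f), hgf, hξ⟩
  rw [cocycle, dif_pos hex]
  obtain ⟨hga, hξa⟩ := hex.choose_spec
  set a := hex.choose
  obtain ⟨p, hp, rfl, hpξ⟩ := mem_cylinder_iff.1 hξ
  obtain ⟨q, hq, hqa, hqξ⟩ := mem_cylinder_iff.1 hξa
  rw [← hqa] at hga ⊢
  rw [← w.ν_div_eq hp hgf (le_max_left n a.1), ← w.ν_div_eq hq hga (le_max_right n a.1),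
    hp.eq_of_mem_cylinder hpξ (le_max_left n a.1) (hq.mem_cylinder hqξ (le_max_right n a.1))]

section

variable [TopologicalSpace G] [DiscreteTopology G]

lemma continuous_cocycle (hA : S.Absorbing) (g : G) : Continuous (w.cocycle g) := by
  refine continuous_iff_continuousAt.2 fun ξ => ?_
  obtain ⟨n, f, ⟨-, hgf⟩, hξ⟩ := (hA.eventually_mem_cylinder g ξ).exists
  have : w.cocycle g =ᶠ[𝓝 ξ] fun _ => w.ν n (g * f) / w.ν n f := by
    filter_upwards [(isOpen_cylinder n f).mem_nhds hξ] with ζ hζ using w.cocycle_eq hgf hζ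
  exact (continuousAt_congr this).2 continuousAt_const

lemma isCocycle_cocycle [MulAction G S.Space] (hA : S.Absorbing) (hG : S.IsCFAction) :
    IsCocycle w.cocycle where
  measurable g := (w.continuous_cocycle hA g).measurable
  pos g ξ := by
    obtain ⟨n, f, ⟨hf, hgf⟩, hξ⟩ := (hA.eventually_mem_cylinder g ξ).exists
    rw [w.cocycle_eq hgf hξ]
    exact div_pos (w.ν_pos n _ hgf) (w.ν_pos n _ hf)
  mul g₁ g₂ ξ := by
    obtain ⟨n, ⟨f, ⟨-, h1⟩, hξ⟩, ⟨f', ⟨-, h2⟩, hξ'⟩⟩ :=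
      ((hA.eventually_mem_cylinder g₁ ξ).and (hA.eventually_mem_cylinder (g₂ * g₁) ξ)).exists
    obtain rfl := eq_of_mem_cylinder hξ hξ'
    rw [w.cocycle_eq h1 hξ, w.cocycle_eq h2 hξ,
      w.cocycle_eq (by rwa [← mul_assoc]) (hG.smul_mem_cylinder h1 hξ), mul_assoc,
      div_mul_div_cancel₀ (w.ν_pos n _ h1).ne']

lemma withDensity_cocycle_cylinder (γ : Measure S.Space) {g : G} {n : ℕ} {f : G}
    (hgf : g * f ∈ S.F n) :
    γ.withDensity (fun ξ => (w.cocycle g ξ : ℝ≥0∞)) (S.cylinder n f) =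
      (w.ν n (g * f) / w.ν n f : ℝ≥0) * γ (S.cylinder n f) := by
  rw [withDensity_apply _ (measurableSet_cylinder n f),
    setLIntegral_congr_fun (measurableSet_cylinder n f)
      (fun ξ hξ => by rw [w.cocycle_eq hgf hξ]), setLIntegral_const]

end

namespace IsCFMeasure

variable [TopologicalSpace G] [DiscreteTopology G] [Countable G]
  {w : CFWeights S} {μ : Measure S.Space}

lemma regular (hμ : w.IsCFMeasure μ) : μ.Regular := by
  have : IsLocallyFiniteMeasure μ := ⟨fun ξ => by
    obtain ⟨n, f, hf, hξ⟩ := (eventually_mem_cylinder ξ).exists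
    exact ⟨_, (isOpen_cylinder n f).mem_nhds hξ, hμ n f hf ▸ ENNReal.coe_lt_top⟩⟩
  infer_instance

variable [MulAction G S.Space] (hμ : w.IsCFMeasure μ) (hA : S.Absorbing) (hG : S.IsCFAction)
include hμ hA hG

lemma hasRNCocycle : HasRNCocycle μ w.cocycle := by
  have := hμ.regular
  have := hG.continuousConstSMul hA
  refine (hasRNCocycle_iff_compMeasure_eq fun g => (w.continuous_cocycle hA g).measurable).2
    fun g => measure_ext (hA.eventually_mem_cylinder g) ?_ ?_
  · rintro n f ⟨hf, hgf⟩
    rw [hG.compMeasure_cylinder hA μ hf hgf, hμ n _ hgf]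
    exact ENNReal.coe_ne_top
  · rintro n f ⟨hf, hgf⟩
    rw [hG.compMeasure_cylinder hA μ hf hgf, w.withDensity_cocycle_cylinder μ hgf, hμ n _ hgf,
      hμ n f hf, ← ENNReal.coe_mul, div_mul_cancel₀ _ (w.ν_pos n f hf).ne']

lemma isRadonCocycleUniquelyErgodic : IsRadonCocycleUniquelyErgodic w.cocycle := by
  have := hμ.regular
  have := hG.continuousConstSMul hA
  have h0 : ∀ n, μ (S.cylinder n 1) ≠ 0 := fun n => by
    rw [hμ n 1 (S.one_mem_F n), ENNReal.coe_ne_zero]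
    exact (w.ν_pos n 1 (S.one_mem_F n)).ne'
  refine ⟨μ, fun h => h0 0 (by simp [h]), hμ.regular, hμ.hasRNCocycle hA hG,
    fun γ hγ hργ => ⟨_, eq_smul_of_measure_cylinder_eq (μ := μ) h0
      (t := fun n => (γ (S.cylinder n 1)).toNNReal / w.ν n 1) fun n f hf => ?_⟩⟩
  have hf' : f * 1 ∈ S.F n := by rwa [mul_one]
  -- the cocycle prescribes the ratios of the masses of the cylinders of a level
  have hratio : γ (S.cylinder n f) = (w.ν n f / w.ν n 1 : ℝ≥0) * γ (S.cylinder n 1) := by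
    rw [← mul_one f, ← hG.compMeasure_cylinder hA γ (S.one_mem_F n) hf',
      (hasRNCocycle_iff_compMeasure_eq fun g => (w.continuous_cocycle hA g).measurable).1 hργ,
      w.withDensity_cocycle_cylinder γ hf']
  rw [hratio, hμ n f hf, ← ENNReal.coe_toNNReal (measure_cylinder_lt_top γ n 1).ne,
    ← ENNReal.coe_mul, ← ENNReal.coe_mul, ENNReal.toNNReal_coe]
  congr 1
  ring

end IsCFMeasure

end CFWeights

/-! ### Existence of the `(C,F)`-measure -/

namespace CFShape

variable {G : Type*} [Group G] {S : CFShape G}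

lemma path_eq_path_iff {k : ℕ} {x y : S.Level k} (h : y.1 = x.1) {n : ℕ} (hn : k ≤ n) :
    S.path k y n = S.path k x n ↔
      ∀ m : {m : ℕ // k < m}, m.1 ≤ n → y.2 m = x.2 m := by
  induction n, hn using Nat.le_induction with
  | base => simpa [path_of_le, h] using fun m hm hmk => absurd hm hmk.not_gt
  | succ n hn ih =>
    refine ⟨fun he => ?_, fun he => ?_⟩
    · have hen := (isPathFrom_path y).eq_of_succ (isPathFrom_path x) hn he
      rintro ⟨m, hm⟩ hmn
      rcases Nat.le_succ_iff.1 hmn with hle | rfl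
      · exact ih.1 hen _ hle
      · rw [path_succ y hn, path_succ x hn, hen] at he
        exact Subtype.ext (mul_left_cancel he)
    · rw [path_succ y hn, path_succ x hn, he _ le_rfl, ih.2 fun m hm => he m (hm.trans n.le_succ)]

lemma mem_range_point {n : ℕ} {f : G} {ξ : S.Space} (h : ξ ∈ S.cylinder n f) :
    ξ ∈ range (S.point n) := by
  obtain ⟨y, -, rfl⟩ := h
  exact mem_range_self y

lemma cylinder_subset_range_point {n : ℕ} {f : G} {k : ℕ} (hkn : k ≤ n) {ξ : S.Space}
    (hξ : ξ ∈ S.cylinder n f) (hk : ξ ∈ range (S.point k)) :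
    S.cylinder n f ⊆ range (S.point k) := by
  obtain ⟨x, rfl⟩ := hk
  exact fun ζ hζ => mem_range_point (cylinder_subset_of_mem hkn ⟨x, rfl, rfl⟩ hξ hζ)

lemma exists_cylinder_subset_disjointed {n : ℕ} {f : G} (hf : f ∈ S.F n) :
    ∃ m ≤ n, S.cylinder n f ⊆ disjointed (fun k => range (S.point k)) m := by
  classical
  obtain ⟨ξ, hξ⟩ := cylinder_nonempty hf
  have hex : ∃ k, ξ ∈ range (S.point k) := ⟨n, mem_range_point hξ⟩
  have hle : Nat.find hex ≤ n := Nat.find_min' hex (mem_range_point hξ)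
  refine ⟨Nat.find hex, hle, fun ζ hζ => ?_⟩
  rw [disjointed_eq_inter_compl]
  exact ⟨cylinder_subset_range_point hle hξ (Nat.find_spec hex) hζ, mem_iInter₂.2 fun k hk h =>
    Nat.find_min hex hk (cylinder_subset_range_point (hk.le.trans hle) hζ h hξ)⟩

end CFShape

/-- The measure on the finite set `s` with weights `v`. -/
def weightMeasure {α : Type*} [MeasurableSpace α] (s : Finset α) (v : α → ℝ≥0) :
    Measure {a // a ∈ s} :=
  Measure.sum fun a : {a // a ∈ s} => (v a : ℝ≥0∞) • Measure.dirac a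

lemma weightMeasure_singleton {α : Type*} [MeasurableSpace α] [MeasurableSingletonClass α]
    (s : Finset α) (v : α → ℝ≥0) (a : {a // a ∈ s}) : weightMeasure s v {a} = v a :=
  Measure.sum_smul_dirac_singleton

lemma weightMeasure_univ {α : Type*} [MeasurableSpace α] (s : Finset α) (v : α → ℝ≥0) :
    weightMeasure s v univ = ∑ a ∈ s, (v a : ℝ≥0∞) := by
  simp [weightMeasure, s.sum_attach fun a => (v a : ℝ≥0∞)]

namespace CFWeights

variable {G : Type*} [Group G] {S : CFShape G} (w : CFWeights S)

section

variable [MeasurableSpace G]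

instance isProbabilityMeasure_weightMeasure {n : ℕ} (m : {m : ℕ // n < m}) :
    IsProbabilityMeasure (weightMeasure (S.C m) (w.κ m)) :=
  ⟨by rw [weightMeasure_univ]; exact_mod_cast w.κ_sum m (Nat.one_le_of_lt m.2)⟩

/-- The product measure `ν_n × κ_{n+1} × κ_{n+2} × ⋯` on `X_n`. -/
def levelMeasure (n : ℕ) : Measure (S.Level n) :=
  (weightMeasure (S.F n) (w.ν n)).prod
    (Measure.infinitePi fun m : {m : ℕ // n < m} => weightMeasure (S.C m) (w.κ m))

lemma levelMeasure_preimage_cylinder [MeasurableSingletonClass G] {k n : ℕ} (hn : k ≤ n)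
    (x : S.Level k) :
    w.levelMeasure k (S.point k ⁻¹' S.cylinder n (S.path k x n)) = w.ν n (S.path k x n) := by
  have hpre : S.point k ⁻¹' S.cylinder n (S.path k x n) = {x.1} ×ˢ
      Set.pi ((Finset.Ioc k n).subtype fun m => k < m : Finset {m : ℕ // k < m})
        fun m => {x.2 m} := by
    ext y
    rw [mem_preimage, point_mem_cylinder_iff hn]
    have : S.path k y n = S.path k x n → y.1 = x.1 := fun h => by
      have := (isPathFrom_path y).eq_of_eq (isPathFrom_path x) le_rfl hn h
      rwa [path_of_le _ le_rfl, path_of_le _ le_rfl, ← Subtype.ext_iff] at this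
    simp only [mem_prod, mem_singleton_iff, Set.mem_pi, Finset.mem_coe, Finset.mem_subtype,
      Finset.mem_Ioc]
    exact ⟨fun h => ⟨this h, fun m hm => (path_eq_path_iff (this h) hn).1 h m hm.2⟩,
      fun h => (path_eq_path_iff h.1 hn).2 fun m hm => h.2 m ⟨m.2, hm⟩⟩
  have hκ : ∀ m : {m : ℕ // k < m}, (x.2 m : G) = (S.path k x (m - 1))⁻¹ * S.path k x m := by
    rintro ⟨m, hm⟩
    obtain ⟨j, rfl⟩ : ∃ j, m = j + 1 := ⟨m - 1, by omega⟩
    simp [path_succ x (Nat.lt_succ_iff.1 hm)]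
  rw [hpre, levelMeasure, Measure.prod_prod,
    Measure.infinitePi_pi _ fun _ _ => measurableSet_singleton _,
    w.ν_eq_mul_prod (isPathFrom_path x) hn, path_of_le x le_rfl]
  simp only [weightMeasure_singleton, hκ]
  rw [Finset.prod_subtype_eq_prod_filter (fun m =>
    (w.κ m ((S.path k x (m - 1))⁻¹ * S.path k x m) : ℝ≥0∞)), Finset.filter_true_of_mem
    fun m hm => (Finset.mem_Ioc.1 hm).1]
  push_cast
  rfl

variable [TopologicalSpace G] [DiscreteTopology G] [Countable G]

theorem isCFMeasure_sum_levelMeasure [BorelSpace G] :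
    w.IsCFMeasure (Measure.sum fun k => ((w.levelMeasure k).map (S.point k)).restrict
      (disjointed (fun k => range (S.point k)) k)) := by
  intro n f hf
  have hm := measurableSet_cylinder (S := S) n f
  obtain ⟨k, hkn, hk⟩ := exists_cylinder_subset_disjointed hf
  rw [Measure.sum_apply _ hm, tsum_eq_single k, Measure.restrict_apply hm, inter_eq_left.2 hk,
    Measure.map_apply (continuous_point k).measurable hm]
  · obtain ⟨ξ, hξ⟩ := cylinder_nonempty hf
    obtain ⟨x, rfl⟩ := disjointed_subset _ _ (hk hξ)
    rw [← (point_mem_cylinder_iff hkn).1 hξ, w.levelMeasure_preimage_cylinder hkn]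
  · intro j hj
    rw [Measure.restrict_apply hm, ((disjoint_disjointed _ hj.symm).mono_left hk).inter_eq,
      measure_empty]

end

theorem exists_isCFMeasure [TopologicalSpace G] [DiscreteTopology G] [Countable G] :
    ∃ μ : Measure S.Space, w.IsCFMeasure μ := by
  borelize G
  exact ⟨_, w.isCFMeasure_sum_levelMeasure⟩

end CFWeights

/-! ### The invariant measure of a `(C,F)`-action -/

namespace CFWeights

variable {G : Type*} [Group G] (S : CFShape G)

/-- The equidistributed weights, with total mass `1` on `X_0`. -/
def uniform : CFWeights S where
  κ n _ := ((S.C n).card : ℝ≥0)⁻¹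
  ν n _ := ∏ i ∈ Finset.Icc 1 n, ((S.C i).card : ℝ≥0)⁻¹
  κ_pos n hn c hc := inv_pos.2 (Nat.cast_pos.2 (Finset.card_pos.2 ⟨c, hc⟩))
  κ_sum n hn := by
    rw [Finset.sum_const, nsmul_eq_mul, mul_inv_cancel₀]
    exact Nat.cast_ne_zero.2 (Finset.card_ne_zero_of_mem (S.one_mem_C n hn))
  ν_pos n f _ := Finset.prod_pos fun i hi =>
    inv_pos.2 (Nat.cast_pos.2 (Finset.card_pos.2 ⟨1, S.one_mem_C i (Finset.mem_Icc.1 hi).1⟩))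
  prod_max := by
    refine tendsto_of_tendsto_of_tendsto_of_le_of_le tendsto_const_nhds
      (NNReal.tendsto_pow_atTop_nhds_zero_of_lt_one (r := 2⁻¹) (by norm_num)) (fun _ => zero_le)
      fun N => ?_
    calc
      _ ≤ ∏ _n ∈ Finset.Icc 1 N, (2⁻¹ : ℝ≥0) := by
          refine Finset.prod_le_prod' fun n hn => Finset.sup_le fun c _ => ?_
          refine inv_anti₀ (by norm_num) ?_
          exact_mod_cast S.one_lt_card_C n (Finset.mem_Icc.1 hn).1
      _ = 2⁻¹ ^ N := by simp
  ν_mul _ _ _ _ _ := by rw [Finset.prod_Icc_succ_top (by omega)]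

end CFWeights

namespace CFShape

variable {G : Type*} [Group G] {S : CFShape G}

lemma Absorbing.cocycle_uniform (hA : S.Absorbing) : (CFWeights.uniform S).cocycle = 1 := by
  funext g ξ
  obtain ⟨n, f, ⟨hf, hgf⟩, hξ⟩ := (hA.eventually_mem_cylinder g ξ).exists
  rw [CFWeights.cocycle_eq _ hgf hξ]
  exact div_self ((CFWeights.uniform S).ν_pos n f hf).ne'

variable [TopologicalSpace G] [DiscreteTopology G] [Countable G] [MulAction G S.Space]

theorem IsCFAction.isRadonUniquelyErgodic (hG : S.IsCFAction) (hA : S.Absorbing) :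
    IsRadonUniquelyErgodic G S.Space := by
  have := hG.continuousConstSMul hA
  have hinv (γ : Measure S.Space) (_ : γ.Regular) :
      HasRNCocycle γ (1 : G → S.Space → ℝ≥0) ↔ SMulInvariantMeasure G S.Space γ :=
    hasRNCocycle_one_iff
  obtain ⟨μ, hμ⟩ := (CFWeights.uniform S).exists_isCFMeasure
  obtain ⟨γ, h0, hγ, hργ, huniq⟩ :=
    hA.cocycle_uniform ▸ hμ.isRadonCocycleUniquelyErgodic hA hG
  exact ⟨γ, h0, hγ, (hinv γ hγ).1 hργ, fun γ' h' hinv' => huniq γ' h' ((hinv γ' h').2 hinv')⟩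

theorem IsCFAction.existsUnique_regular_invariant (hG : S.IsCFAction) (hA : S.Absorbing) :
    ∃! ξ : Measure S.Space, ξ.Regular ∧ SMulInvariantMeasure G S.Space ξ ∧
      ξ (range (S.point 0)) = 1 := by
  have := hG.continuousConstSMul hA
  have := hG.isMinimal
  rw [range_point_zero]
  exact (hG.isRadonUniquelyErgodic hA).existsUnique_measure_eq_one (isCompact_cylinder 0 1)
    (isOpen_cylinder 0 1) (cylinder_nonempty (S.one_mem_F 0))

end CFShape

/-! ### Isomorphisms modulo null sets -/

lemma standardBorelSpace_of_measurableEquiv {X Y : Type*} [MeasurableSpace X]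
    [MeasurableSpace Y] [StandardBorelSpace Y] (e : X ≃ᵐ Y) : StandardBorelSpace X := by
  let := upgradeStandardBorel Y
  let : TopologicalSpace X := TopologicalSpace.induced e inferInstance
  refine ⟨⟨inferInstance, ⟨?_⟩, e.toEquiv.polishSpace_induced⟩⟩
  rw [borel_comap, ← BorelSpace.measurable_eq (α := Y)]
  exact e.measurableEmbedding.comap_eq.symm

-- The space is σ-compact, hence Borel in its metric completion.
lemma standardBorelSpace_of_locallyCompact {X : Type*} [TopologicalSpace X] [T2Space X]
    [LocallyCompactSpace X] [SecondCountableTopology X] [MeasurableSpace X] [BorelSpace X] :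
    StandardBorelSpace X := by
  let : MetricSpace X := TopologicalSpace.metrizableSpaceMetric X
  let Y := UniformSpace.Completion X
  borelize Y
  have hemb : IsEmbedding ((↑) : X → Y) :=
    (UniformSpace.Completion.isUniformEmbedding_coe X).isEmbedding
  have hrange : MeasurableSet (range ((↑) : X → Y)) := by
    obtain ⟨K, hK, hKX⟩ := isSigmaCompact_range hemb.continuous
    exact hKX ▸ .iUnion fun n => (hK n).measurableSet
  have : TopologicalSpace.SeparableSpace Y :=
    UniformSpace.Completion.denseRange_coe.separableSpace hemb.continuous
  have : StandardBorelSpace (range ((↑) : X → Y)) := hrange.standardBorel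
  exact standardBorelSpace_of_measurableEquiv (hemb.measurableEmbedding hrange).equivRange

/-- If `Ω` is uncountable, it is Borel isomorphic to the plane, and only countably many vertical
lines of the plane are charged. -/
lemma exists_null_not_countable {Z : Type*} [MeasurableSpace Z] [StandardBorelSpace Z]
    (η : Measure Z) [SFinite η] {Ω : Set Z} (hΩ : MeasurableSet Ω) (hc : ¬ Ω.Countable) :
    ∃ N ⊆ Ω, MeasurableSet N ∧ η N = 0 ∧ ¬ N.Countable := by
  have := hΩ.standardBorel
  have hR : ¬ Countable (ℝ × ℝ) := not_countable_iff.2 inferInstance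
  let e : Ω ≃ᵐ ℝ × ℝ := PolishSpace.measurableEquivOfNotCountable (mt countable_coe_iff.1 hc) hR
  let i : ℝ × ℝ → Z := fun p => e.symm p
  have hi : MeasurableEmbedding i :=
    (MeasurableEmbedding.subtype_coe hΩ).comp e.symm.measurableEmbedding
  have hline (t : ℝ) : MeasurableSet (i '' ({t} ×ˢ univ)) :=
    hi.measurableSet_image.2 ((measurableSet_singleton t).prod .univ)
  have hdisj : Pairwise (Function.onFun Disjoint fun t => i '' ({t} ×ˢ univ)) := fun s t hst =>
    (disjoint_image_iff hi.injective).2 (disjoint_prod.2 (.inl (disjoint_singleton.2 hst)))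
  obtain ⟨t, ht⟩ : ∃ t, ¬ 0 < η (i '' ({t} ×ˢ univ)) := by
    by_contra! h
    have := Measure.countable_meas_pos_of_disjoint_iUnion (μ := η) hline hdisj
    exact not_countable_univ (this.mono fun t _ => h t)
  refine ⟨_, ?_, hline t, by simpa using ht, fun h => ?_⟩
  · rintro _ ⟨p, -, rfl⟩
    exact (e.symm p).2
  · refine not_countable_univ (α := ℝ) (MapsTo.countable_of_injOn (f := fun s => i (t, s)) ?_ ?_ h)
    · exact fun s _ => mem_image_of_mem i ⟨rfl, trivial⟩
    · exact (hi.injective.comp (Prod.mk_right_injective t)).injOn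

lemma exists_measurableEquiv_extend {Z X : Type*} [MeasurableSpace Z] [StandardBorelSpace Z]
    [MeasurableSpace X] [StandardBorelSpace X] {D : Set Z} (hD : MeasurableSet D) {f : D → X}
    (hf : MeasurableEmbedding f) (hDc : ¬ Dᶜ.Countable) (hEc : ¬ (range f)ᶜ.Countable) :
    ∃ ψ : Z ≃ᵐ X, ∀ z : D, ψ z = f z := by
  classical
  have hE := hf.measurableSet_range
  have := hD.standardBorel
  have := hD.compl.standardBorel
  have := hE.compl.standardBorel
  let e : ↥Dᶜ ≃ᵐ ↥(range f)ᶜ := PolishSpace.measurableEquivOfNotCountable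
    (mt countable_coe_iff.1 hDc) (mt countable_coe_iff.1 hEc)
  refine ⟨(MeasurableEquiv.sumCompl hD).symm.trans
    ((MeasurableEquiv.sumCongr hf.equivRange e).trans (MeasurableEquiv.sumCompl hE)), fun z => ?_⟩
  have hz : (MeasurableEquiv.sumCompl hD).symm z = Sum.inl z :=
    Equiv.Set.sumCompl_symm_apply_of_mem z.2
  simp only [MeasurableEquiv.trans_apply, hz]
  exact congrArg Subtype.val (hf.equivRange_apply z)

theorem exists_measurableEquiv_ae_eq {Z X : Type*} [MeasurableSpace Z] [StandardBorelSpace Z]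
    [MeasurableSpace X] [StandardBorelSpace X] (η : Measure Z) [SFinite η] {Ω : Set Z}
    (hΩ : MeasurableSet Ω) (hc : ¬ Ω.Countable) (hη : η Ωᶜ = 0) {φ : Z → X} (hφ : Measurable φ)
    (hinj : InjOn φ Ω) : ∃ ψ : Z ≃ᵐ X, ψ =ᵐ[η] φ := by
  obtain ⟨N, hNΩ, hN, hN0, hNc⟩ := exists_null_not_countable η hΩ hc
  have hD : MeasurableSet (Ω \ N) := hΩ.diff hN
  have := hD.standardBorel
  let f : ↥(Ω \ N) → X := fun z => φ z
  have hf : MeasurableEmbedding f := (hφ.comp measurable_subtype_coe).measurableEmbedding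
    (injOn_iff_injective.1 (hinj.mono sdiff_subset))
  have hND : N ⊆ (Ω \ N)ᶜ := fun z hz h => h.2 hz
  have hφN : MapsTo φ N (range f)ᶜ := by
    rintro z hz ⟨y, hy⟩
    exact y.2.2 (hinj y.2.1 (hNΩ hz) hy ▸ hz)
  obtain ⟨ψ, hψ⟩ := exists_measurableEquiv_extend hD hf
    (fun h => hNc (h.mono hND)) (fun h => hNc (hφN.countable_of_injOn (hinj.mono hNΩ) h))
  refine ⟨ψ, ?_⟩
  filter_upwards [measure_eq_zero_iff_ae_notMem.1 hη, measure_eq_zero_iff_ae_notMem.1 hN0]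
    with z hzΩ hzN
  exact hψ ⟨z, not_not.1 hzΩ, hzN⟩

/-! ### Towers of a rank-one action off an invariant null set -/

lemma exists_mul_mem_of_smul_mem_orbitPiece {G : Type*} [Group G] {Z : Type*} [MulAction G Z]
    {B : Set Z} {F : Finset G} {x : Z} (hx : ∀ g : G, g ≠ 1 → g • x ≠ x) {g : G}
    (h : g • x ∈ orbitPiece B F x) :
    ∃ f ∈ F, x ∈ f • B ∧ g * f ∈ F := by
  obtain ⟨f, hf, hxf, k, hk, hgk⟩ := h
  have hg : (k * f⁻¹)⁻¹ * g = 1 :=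
    by_contra fun hne => hx _ hne (by rw [mul_smul, hgk, inv_smul_smul])
  refine ⟨f, hf, hxf, ?_⟩
  rwa [← inv_mul_eq_one.1 hg, inv_mul_cancel_right]

section QuasiInvariant

variable {G : Type*} [Group G] {Z : Type*} [MeasurableSpace Z] [MulAction G Z] {η : Measure Z}

lemma QuasiInvariant.measurableConstSMul (hns : QuasiInvariant G η) : MeasurableConstSMul G Z :=
  ⟨fun g => (hns g).measurable⟩

lemma QuasiInvariant.measure_smul_eq_zero_iff (hns : QuasiInvariant G η) (g : G) {N : Set Z} :
    η (g • N) = 0 ↔ η N = 0 := by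
  have key (g : G) {N : Set Z} (hN : η N = 0) : η (g • N) = 0 := by
    rw [← Set.preimage_smul_inv]
    exact (hns g⁻¹).preimage_null hN
  exact ⟨fun h => inv_smul_smul g N ▸ key g⁻¹ h, key g⟩

lemma QuasiInvariant.exists_invariant_conull [Countable G] (hns : QuasiInvariant G η) {p : Z → Prop}
    (hp : ∀ᵐ x ∂η, p x) :
    ∃ Ω : Set Z, MeasurableSet Ω ∧ η Ωᶜ = 0 ∧ (∀ g : G, g • Ω = Ω) ∧ ∀ x ∈ Ω, p x := by
  have := hns.measurableConstSMul
  let N := toMeasurable η {x | ¬ p x}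
  have hN : η N = 0 := (measure_toMeasurable _).trans hp
  refine ⟨⋂ g : G, g • Nᶜ, .iInter fun g => (measurableSet_toMeasurable _ _).compl.const_smul g,
    ?_, fun g => ?_, fun x hx => ?_⟩
  · simp only [compl_iInter, ← smul_set_compl, compl_compl]
    exact measure_iUnion_null fun g => (hns.measure_smul_eq_zero_iff g).2 hN
  · simp only [smul_set_iInter, smul_smul]
    exact (Group.mulLeft_bijective g).surjective.iInter_comp fun h => h • Nᶜ
  · have hxN : x ∉ N := by simpa using mem_iInter.1 hx 1
    exact not_not.1 fun h => hxN (subset_toMeasurable _ _ h)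

lemma IsRokhlinTower.exists_measure_smul_eq [SigmaFinite η] (hns : QuasiInvariant G η) {B : Set Z}
    {F : Finset G} (hB : IsRokhlinTower η B F) {f : G} (hf : f ∈ F) :
    ∃ c : ℝ≥0, 0 < c ∧ ∀ E ⊆ B, MeasurableSet E → η (f • E) = c * η E := by
  have := hns.measurableConstSMul
  obtain ⟨c, hc⟩ := hB.const_rnDeriv f hf
  have : SigmaFinite (compMeasure η f) := (MeasurableEquiv.smul f⁻¹).sigmaFinite_map
  have hac : compMeasure η f ≪ η := (hns f⁻¹).absolutelyContinuous
  have hE : ∀ E ⊆ B, MeasurableSet E → η (f • E) = c * η E := fun E hEB _ => by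
    rw [← compMeasure_apply η f E, ← Measure.setLIntegral_rnDeriv hac,
      lintegral_congr_ae (ae_restrict_of_ae_restrict_of_subset hEB hc), setLIntegral_const]
  have hc_top : c ≠ ∞ := by
    have : (ae (η.restrict B)).NeBot := ae_restrict_neBot.2 hB.pos.ne'
    have hlt := ae_restrict_of_ae (s := B) (Measure.rnDeriv_lt_top (compMeasure η f) η)
    obtain ⟨x, hx, hxc⟩ := (hlt.and hc).exists
    exact (hxc.symm.trans_lt hx).ne
  have hc0 : c ≠ 0 := by
    rintro rfl
    exact hB.pos.ne' ((hns.measure_smul_eq_zero_iff f).1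
      ((hE B Subset.rfl hB.measurableSet).trans (zero_mul _)))
  refine ⟨c.toNNReal, ENNReal.toNNReal_pos hc0 hc_top, ?_⟩
  rwa [ENNReal.coe_toNNReal hc_top]

end QuasiInvariant

/-- Towers `(A n, F n)` of a rank-one action with the defining properties holding everywhere on an
invariant conull set `Ω`. The convergence of the orbit pieces and the constancy of the derivatives
are stated in terms of the shapes `F n` and of the measures of subsets of the levels. -/
structure ExactTowers {G : Type*} [Group G] {Z : Type*} [MeasurableSpace Z] [MulAction G Z]
    (η : Measure Z) (F : ℕ → Finset G) where
  Ω : Set Z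
  A : ℕ → Set Z
  measure_compl : η Ωᶜ = 0
  smul_Ω : ∀ g : G, g • Ω = Ω
  A_subset : ∀ n, A n ⊆ Ω
  measurableSet_A : ∀ n, MeasurableSet (A n)
  pos : ∀ n, 0 < η (A n)
  lt_top : ∀ n, η (A n) < ∞
  one_mem : ∀ n, 1 ∈ F n
  disjoint : ∀ n, ∀ f ∈ F n, ∀ f' ∈ F n, f ≠ f' → Disjoint (f • A n) (f' • A n)
  refinement : ∀ n, ∀ f ∈ F n, ∃ H ⊆ F (n + 1), f • A n = ⋃ h ∈ H, h • A (n + 1)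
  scale : ∀ n, ∀ f ∈ F n, ∃ c : ℝ≥0, 0 < c ∧
    ∀ E ⊆ A n, MeasurableSet E → η (f • E) = c * η E
  eventually_mem : ∀ x ∈ Ω, ∀ g : G, ∀ᶠ n in atTop, ∃ f ∈ F n, x ∈ f • A n ∧ g * f ∈ F n
  separate : ∀ x ∈ Ω, ∀ y ∈ Ω, x ≠ y → ∃ n, ∃ f ∈ F n, x ∈ f • A n ∧ y ∉ f • A n

variable {G : Type*} [Group G] {Z : Type*} [MeasurableSpace Z] [MulAction G Z] {η : Measure Z}

theorem IsRankOneAlong.nonempty_exactTowers [Countable G] [SigmaFinite η]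
    (hns : QuasiInvariant G η) (hfree : FreeAE G η) {Q : ℕ → Finset G}
    (hQ : IsRankOneAlong η Q) : Nonempty (ExactTowers η Q) := by
  obtain ⟨-, -, B, -, hB, href, ⟨X₀, hX₀, -, hsep⟩, horb⟩ := hQ
  choose! S hSQ hS using href
  have hrefine : ∀ᵐ x ∂η, ∀ n, ∀ f ∈ Q n, x ∈ f • B n ↔ x ∈ ⋃ h ∈ S n f, h • B (n + 1) :=
    ae_all_iff.2 fun n => (ae_ball_iff (Q n).countable_toSet).2 fun f hf => (hS n f hf).mem_iff
  have hevent : ∀ᵐ x ∂η, ∀ g : G, ∀ᶠ n in atTop, ∃ f ∈ Q n, x ∈ f • B n ∧ g * f ∈ Q n := by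
    have hfree' : ∀ᵐ x ∂η, ∀ g : G, g ≠ 1 → g • x ≠ x :=
      ae_all_iff.2 fun g => eventually_imp_distrib_left.2 (hfree g)
    filter_upwards [hfree', horb] with x hx hxorb g
    exact (hxorb g).mono fun n => exists_mul_mem_of_smul_mem_orbitPiece hx
  obtain ⟨Ω, hΩm, hΩ, hΩG, hΩp⟩ := hns.exists_invariant_conull (hrefine.and (hevent.and hX₀))
  have hinter (f : G) (E : Set Z) : f • (E ∩ Ω) = f • E ∩ Ω := by rw [smul_set_inter, hΩG]
  have hη (n : ℕ) : η (B n ∩ Ω) = η (B n) := measure_inter_conull hΩ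
  exact ⟨{
    Ω := Ω
    A := fun n => B n ∩ Ω
    measure_compl := hΩ
    smul_Ω := hΩG
    A_subset := fun n => inter_subset_right
    measurableSet_A := fun n => (hB n).measurableSet.inter hΩm
    pos := fun n => (hη n).symm ▸ (hB n).pos
    lt_top := fun n => (hη n).symm ▸ (hB n).lt_top
    one_mem := fun n => (hB n).one_mem
    disjoint := fun n f hf f' hf' hne => ((hB n).disjoint f hf f' hf' hne).mono
      (smul_set_mono inter_subset_left) (smul_set_mono inter_subset_left)
    refinement := fun n f hf => by
      refine ⟨S n f, hSQ n f hf, ?_⟩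
      simp only [hinter, ← iUnion_inter]
      exact Set.ext fun x => and_congr_left fun hx => (hΩp x hx).1 n f hf
    scale := fun n f hf => by
      obtain ⟨c, hc, h⟩ := (hB n).exists_measure_smul_eq hns hf
      exact ⟨c, hc, fun E hE => h E (hE.trans inter_subset_left)⟩
    eventually_mem := fun x hx g => by
      filter_upwards [(hΩp x hx).2.1 g] with n ⟨f, hf, hxf, hgf⟩
      exact ⟨f, hf, hinter f _ ▸ ⟨hxf, hx⟩, hgf⟩
    separate := fun x hx y hy hne => by
      obtain ⟨n, f, hf, hxf, hyf⟩ := hsep x (hΩp x hx).2.2 y (hΩp y hy).2.2 hne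
      exact ⟨n, f, hf, hinter f _ ▸ ⟨hxf, hx⟩, fun h => hyf (hinter f _ ▸ h).1⟩ }⟩

namespace ExactTowers

section Levels

variable {F : ℕ → Finset G} (T : ExactTowers η F)

lemma level_subset_Ω (n : ℕ) (f : G) : f • T.A n ⊆ T.Ω :=
  (smul_set_mono (T.A_subset n)).trans (T.smul_Ω f).subset

lemma eq_of_mem {n : ℕ} {f f' : G} (hf : f ∈ F n) (hf' : f' ∈ F n) {x : Z} (h : x ∈ f • T.A n)
    (h' : x ∈ f' • T.A n) : f = f' := by
  by_contra hne
  exact Set.disjoint_left.1 (T.disjoint n f hf f' hf' hne) h h'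

lemma exists_refinement {n m : ℕ} (hnm : n ≤ m) {f : G} (hf : f ∈ F n) :
    ∃ H ⊆ F m, f • T.A n = ⋃ h ∈ H, h • T.A m := by
  classical
  induction m, hnm using Nat.le_induction with
  | base => exact ⟨{f}, by simpa using hf, by simp⟩
  | succ m _ ih =>
    obtain ⟨H, hH, h⟩ := ih
    choose! R hR hR' using T.refinement m
    refine ⟨H.biUnion R, Finset.biUnion_subset.2 fun a ha => hR a (hH ha), ?_⟩
    rw [h, Finset.set_biUnion_biUnion]
    exact iUnion₂_congr fun a ha => hR' a (hH ha)

lemma level_subset {n m : ℕ} (hnm : n ≤ m) {f h : G} (hf : f ∈ F n) (hh : h ∈ F m) {x : Z}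
    (hx : x ∈ f • T.A n) (hx' : x ∈ h • T.A m) : h • T.A m ⊆ f • T.A n := by
  obtain ⟨H, hH, e⟩ := T.exists_refinement hnm hf
  rw [e] at hx ⊢
  obtain ⟨h', hh', hxh'⟩ := mem_iUnion₂.1 hx
  obtain rfl := T.eq_of_mem hh (hH hh') hx' hxh'
  exact subset_biUnion_of_mem (u := fun h => h • T.A m) hh'

lemma level_pos (hns : QuasiInvariant G η) (n : ℕ) (f : G) : 0 < η (f • T.A n) :=
  pos_iff_ne_zero.2 fun h => (T.pos n).ne' ((hns.measure_smul_eq_zero_iff f).1 h)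

lemma level_lt_top {n : ℕ} {f : G} (hf : f ∈ F n) : η (f • T.A n) < ∞ := by
  obtain ⟨c, -, h⟩ := T.scale n f hf
  rw [h _ Subset.rfl (T.measurableSet_A n)]
  exact ENNReal.mul_lt_top ENNReal.coe_lt_top (T.lt_top n)

lemma eventually_mem_level {x : Z} (hx : x ∈ T.Ω) : ∀ᶠ n in atTop, ∃ f ∈ F n, x ∈ f • T.A n :=
  (T.eventually_mem x hx 1).mono fun _ ⟨f, hf, hxf, _⟩ => ⟨f, hf, hxf⟩

lemma eventually_separate {x y : Z} (hx : x ∈ T.Ω) (hy : y ∈ T.Ω) (hne : x ≠ y) :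
    ∀ᶠ n in atTop, ∀ f ∈ F n, x ∈ f • T.A n → y ∉ f • T.A n := by
  obtain ⟨m, f, hf, h1, h2⟩ := T.separate x hx y hy hne
  filter_upwards [eventually_ge_atTop m] with n hn h hh h3 h4
  exact h2 (T.level_subset hn hf hh h1 h3 h4)

end Levels

section Reindex

variable {Q : ℕ → Finset G} (T : ExactTowers η Q)

lemma exists_measure_smul_eq_of_level {n : ℕ} {z f : G} (hz : z ∈ Q n) (hf : f * z ∈ Q n)
    (hns : QuasiInvariant G η) :
    ∃ c : ℝ≥0, 0 < c ∧ ∀ E ⊆ z • T.A n, MeasurableSet E → η (f • E) = c * η E := by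
  have := hns.measurableConstSMul
  obtain ⟨a, ha, hza⟩ := T.scale n z hz
  obtain ⟨b, hb, hfb⟩ := T.scale n _ hf
  refine ⟨b / a, div_pos hb ha, fun E hE hEm => ?_⟩
  obtain ⟨D, rfl⟩ : ∃ D, E = z • D := ⟨z⁻¹ • E, (smul_inv_smul z E).symm⟩
  have hD : D ⊆ T.A n := smul_set_subset_smul_set_iff.1 hE
  have hDm : MeasurableSet D := inv_smul_smul z D ▸ hEm.const_smul z⁻¹
  rw [smul_smul, hfb D hD hDm, hza D hD hDm, ← mul_assoc, ← ENNReal.coe_mul,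
    div_mul_cancel₀ _ ha.ne']

open Classical in
/-- The subsequence of towers with numbers `l n`, based at the levels `z n • A (l n)` instead of
`A (l n)`. -/
def reindex (hns : QuasiInvariant G η) {l : ℕ → ℕ} (hl : StrictMono l) {z : ℕ → G}
    (hz : ∀ n, z n ∈ Q (l n)) :
    ExactTowers η fun n => (Q (l n)).image fun q => q * (z n)⁻¹ where
  Ω := T.Ω
  A n := z n • T.A (l n)
  measure_compl := T.measure_compl
  smul_Ω := T.smul_Ω
  A_subset n := T.level_subset_Ω _ _
  measurableSet_A n :=
    have := hns.measurableConstSMul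
    (T.measurableSet_A _).const_smul _
  pos n := T.level_pos hns _ _
  lt_top n := T.level_lt_top (hz n)
  one_mem n := Finset.mem_image.2 ⟨z n, hz n, mul_inv_cancel _⟩
  disjoint n := by
    simp only [Finset.forall_mem_image, smul_smul, inv_mul_cancel_right]
    exact fun q hq q' hq' hne => T.disjoint _ q hq q' hq' fun h => hne (h ▸ rfl)
  refinement n := by
    simp only [Finset.forall_mem_image, smul_smul, inv_mul_cancel_right]
    intro q hq
    obtain ⟨H, hH, e⟩ := T.exists_refinement (hl.monotone n.le_succ) hq
    refine ⟨_, Finset.image_subset_image hH, ?_⟩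
    simp only [e, Finset.set_biUnion_finset_image, inv_mul_cancel_right]
  scale n := by
    simp only [Finset.forall_mem_image]
    exact fun q hq => T.exists_measure_smul_eq_of_level (hz n) (by simpa using hq) hns
  eventually_mem x hx g := by
    filter_upwards [hl.tendsto_atTop.eventually (T.eventually_mem x hx g)] with n ⟨q, hq, hxq, hgq⟩
    exact ⟨q * (z n)⁻¹, Finset.mem_image_of_mem _ hq, by simpa [smul_smul] using hxq,
      Finset.mem_image.2 ⟨g * q, hgq, mul_assoc _ _ _⟩⟩
  separate x hx y hy hne := by
    have h := hl.tendsto_atTop.eventually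
      ((T.eventually_mem_level hx).and (T.eventually_separate hx hy hne))
    obtain ⟨n, ⟨q, hq, hxq⟩, hsep⟩ := h.exists
    refine ⟨n, q * (z n)⁻¹, Finset.mem_image_of_mem _ hq, ?_⟩
    simpa [smul_smul] using And.intro hxq (hsep q hq hxq)

end Reindex

section Returns

variable {Q : ℕ → Finset G} (T : ExactTowers η Q)

open Classical in
/-- The levels of tower `m` which lie in the level `z • A l` and whose translates by `k f z⁻¹`,
where `k ∈ K` and `f • A l` is a level of tower `l`, are levels of tower `m` as well. -/
def returns (K : Finset G) (l : ℕ) (z : G) (m : ℕ) : Finset G :=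
  {q ∈ Q m | q • T.A m ⊆ z • T.A l ∧ ∀ k ∈ K, ∀ f ∈ Q l, k * (f * z⁻¹ * q) ∈ Q m}

variable {K : Finset G} {l : ℕ} {z : G}

lemma mem_returns {m : ℕ} {q : G} : q ∈ T.returns K l z m ↔
    q ∈ Q m ∧ q • T.A m ⊆ z • T.A l ∧ ∀ k ∈ K, ∀ f ∈ Q l, k * (f * z⁻¹ * q) ∈ Q m := by
  simp only [returns, Finset.mem_filter]

lemma eventually_mem_returns (K : Finset G) (hz : z ∈ Q l) {x : Z} (hx : x ∈ z • T.A l) :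
    ∀ᶠ m in atTop, ∃ q ∈ T.returns K l z m, x ∈ q • T.A m := by
  have hxΩ := T.level_subset_Ω l z hx
  have hK : ∀ᶠ m in atTop, ∀ k ∈ K, ∀ f ∈ Q l, ∃ q ∈ Q m, x ∈ q • T.A m ∧
      k * (f * z⁻¹) * q ∈ Q m :=
    (Filter.eventually_all_finset K).2 fun k _ => (Filter.eventually_all_finset (Q l)).2
      fun f _ => T.eventually_mem x hxΩ (k * (f * z⁻¹))
  filter_upwards [hK, T.eventually_mem_level hxΩ, eventually_ge_atTop l] with m hK ⟨q, hq, hxq⟩ hm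
  refine ⟨q, T.mem_returns.2 ⟨hq, T.level_subset hm hz hq hx hxq, fun k hk f hf => ?_⟩, hxq⟩
  obtain ⟨q', hq', hxq', h⟩ := hK k hk f hf
  obtain rfl := T.eq_of_mem hq hq' hxq hxq'
  rwa [mul_assoc] at h

lemma eventually_measure_sdiff_returns_le (hns : QuasiInvariant G η) (hz : z ∈ Q l) {ε : ℝ≥0∞}
    (hε : ε ≠ 0) : ∀ᶠ m in atTop,
      η (z • T.A l \ ⋃ q ∈ T.returns K l z m, q • T.A m) ≤ ε * η (z • T.A l) := by
  have := hns.measurableConstSMul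
  have hA : MeasurableSet (z • T.A l) := (T.measurableSet_A l).const_smul z
  have hE (m : ℕ) : MeasurableSet (z • T.A l \ ⋃ q ∈ T.returns K l z m, q • T.A m) :=
    hA.diff (Finset.measurableSet_biUnion _ fun q _ => (T.measurableSet_A m).const_smul q)
  have : IsFiniteMeasure (η.restrict (z • T.A l)) := ⟨by simpa using T.level_lt_top hz⟩
  have hlim := tendsto_measure_of_ae_tendsto_indicator_of_isFiniteMeasure
    (μ := η.restrict (z • T.A l)) atTop MeasurableSet.empty hE (by
      filter_upwards [ae_restrict_mem hA] with x hx
      filter_upwards [T.eventually_mem_returns K hz hx] with m ⟨q, hq, hxq⟩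
      exact iff_of_false (fun h => h.2 (mem_biUnion hq hxq)) (notMem_empty x))
  rw [measure_empty] at hlim
  filter_upwards [hlim.eventually_lt_const (ENNReal.mul_pos hε (T.level_pos hns l z).ne')] with m hm
  rw [Measure.restrict_apply (hE m), inter_eq_left.2 sdiff_subset] at hm
  exact hm.le

lemma eventually_one_lt_card_returns [NullSingletonClass η] (hns : QuasiInvariant G η)
    (hz : z ∈ Q l) : ∀ᶠ m in atTop, 1 < (T.returns K l z m).card := by
  have hA : ¬ (z • T.A l).Subsingleton := fun h => (T.level_pos hns l z).ne' (h.measure_zero η)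
  obtain ⟨x, hx, y, hy, hne⟩ := Set.not_subsingleton_iff.1 hA
  filter_upwards [T.eventually_mem_returns K hz hx, T.eventually_mem_returns K hz hy,
    T.eventually_separate (T.level_subset_Ω l z hx) (T.level_subset_Ω l z hy) hne]
    with m ⟨q, hq, hxq⟩ ⟨q', hq', hyq⟩ hsep
  refine Finset.one_lt_card.2 ⟨q, hq, q', hq', ?_⟩
  rintro rfl
  exact hsep q (T.mem_returns.1 hq).1 hxq hyq

end Returns

/-- A subsequence of towers, with base levels `base n • A (index n)`, such that each base level is
filled by returns up to a summable proportion. -/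
structure Selection {Q : ℕ → Finset G} (T : ExactTowers η Q) (K : ℕ → Finset G) where
  index : ℕ → ℕ
  base : ℕ → G
  index_zero : index 0 = 0
  base_zero : base 0 = 1
  strictMono : StrictMono index
  base_mem : ∀ n, base n ∈ Q (index n)
  base_succ_mem : ∀ n, base (n + 1) ∈ T.returns (K n) (index n) (base n) (index (n + 1))
  one_lt_card : ∀ n, 1 < (T.returns (K n) (index n) (base n) (index (n + 1))).card
  loss : ∀ n, η (base n • T.A (index n) \
    ⋃ q ∈ T.returns (K n) (index n) (base n) (index (n + 1)), q • T.A (index (n + 1))) ≤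
      2⁻¹ ^ n * η (base n • T.A (index n))

section Selection

variable {Q : ℕ → Finset G} (T : ExactTowers η Q)

lemma nonempty_selection [NullSingletonClass η] (hns : QuasiInvariant G η) (K : ℕ → Finset G) :
    Nonempty (T.Selection K) := by
  have hε (n : ℕ) : (2⁻¹ : ℝ≥0∞) ^ n ≠ 0 :=
    pow_ne_zero _ (ENNReal.inv_ne_zero.2 ENNReal.ofNat_ne_top)
  have hstep (n : ℕ) (s : {s : ℕ × G // s.2 ∈ Q s.1}) : ∃ t : {s : ℕ × G // s.2 ∈ Q s.1},
      s.1.1 < t.1.1 ∧ t.1.2 ∈ T.returns (K n) s.1.1 s.1.2 t.1.1 ∧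
      1 < (T.returns (K n) s.1.1 s.1.2 t.1.1).card ∧
      η (s.1.2 • T.A s.1.1 \ ⋃ q ∈ T.returns (K n) s.1.1 s.1.2 t.1.1, q • T.A t.1.1) ≤
        2⁻¹ ^ n * η (s.1.2 • T.A s.1.1) := by
    obtain ⟨m, hm, hcard, hloss⟩ := ((eventually_gt_atTop s.1.1).and
      ((T.eventually_one_lt_card_returns (K := K n) hns s.2).and
        (T.eventually_measure_sdiff_returns_le hns s.2 (hε n)))).exists
    obtain ⟨q, hq⟩ := Finset.card_pos.1 (zero_lt_one.trans hcard)
    exact ⟨⟨(m, q), (T.mem_returns.1 hq).1⟩, hm, hq, hcard, hloss⟩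
  choose next hlt hmem hcard hloss using hstep
  let s (n : ℕ) : {s : ℕ × G // s.2 ∈ Q s.1} := Nat.rec ⟨(0, 1), T.one_mem 0⟩ next n
  exact ⟨{
    index := fun n => (s n).1.1
    base := fun n => (s n).1.2
    index_zero := rfl
    base_zero := rfl
    strictMono := strictMono_nat_of_lt_succ fun n => hlt n (s n)
    base_mem := fun n => (s n).2
    base_succ_mem := fun n => hmem n (s n)
    one_lt_card := fun n => hcard n (s n)
    loss := fun n => hloss n (s n) }⟩

end Selection

namespace Selection

variable {Q : ℕ → Finset G} {T : ExactTowers η Q} {K : ℕ → Finset G} (s : T.Selection K)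

open Classical in
/-- The shapes `F n` of the `(C,F)`-construction: those of the selected towers, counted from their
base levels. -/
def F (n : ℕ) : Finset G := (Q (s.index n)).image fun q => q * (s.base n)⁻¹

open Classical in
/-- The sets `C n`, `n ≥ 1`, of the `(C,F)`-construction: the returns to the base level of the
previous tower, counted from the base level of the next one. -/
def C (n : ℕ) : Finset G :=
  (T.returns (K (n - 1)) (s.index (n - 1)) (s.base (n - 1)) (s.index n)).image
    fun q => q * (s.base n)⁻¹

variable {s} in
lemma mem_F {n : ℕ} {f : G} : f ∈ s.F n ↔ ∃ q ∈ Q (s.index n), q * (s.base n)⁻¹ = f := by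
  simp only [F, Finset.mem_image]

variable {s} in
lemma mem_C {n : ℕ} {c : G} : c ∈ s.C (n + 1) ↔
    ∃ q ∈ T.returns (K n) (s.index n) (s.base n) (s.index (n + 1)), q * (s.base (n + 1))⁻¹ = c := by
  simp only [C, Finset.mem_image, Nat.add_sub_cancel]

/-- The selected towers with their base levels. -/
def towers (hns : QuasiInvariant G η) : ExactTowers η s.F :=
  T.reindex hns s.strictMono s.base_mem

lemma smul_towers_A (hns : QuasiInvariant G η) (n : ℕ) (q : G) :
    (q * (s.base n)⁻¹) • (s.towers hns).A n = q • T.A (s.index n) := by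
  change _ • s.base n • T.A (s.index n) = _
  rw [smul_smul, inv_mul_cancel_right]

lemma smul_towers_A_subset (hns : QuasiInvariant G η) {n : ℕ} {c : G} (hc : c ∈ s.C (n + 1)) :
    c • (s.towers hns).A (n + 1) ⊆ (s.towers hns).A n := by
  obtain ⟨q, hq, rfl⟩ := mem_C.1 hc
  exact s.smul_towers_A hns _ q ▸ (T.mem_returns.1 hq).2.1

lemma mul_mem_F {n : ℕ} {k f c : G} (hk : k ∈ K n) (hf : f ∈ s.F n) (hc : c ∈ s.C (n + 1)) :
    k * (f * c) ∈ s.F (n + 1) := by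
  obtain ⟨q, hq, rfl⟩ := mem_C.1 hc
  obtain ⟨p, hp, rfl⟩ := mem_F.1 hf
  exact mem_F.2 ⟨_, (T.mem_returns.1 hq).2.2 k hk p hp, by group⟩

lemma eq_of_mul_eq_mul (hns : QuasiInvariant G η) {n : ℕ} {f f' c c' : G} (hf : f ∈ s.F n)
    (hf' : f' ∈ s.F n) (hc : c ∈ s.C (n + 1)) (hc' : c' ∈ s.C (n + 1)) (h : f * c = f' * c') :
    c = c' := by
  have hne : ((f * c) • (s.towers hns).A (n + 1)).Nonempty :=
    nonempty_of_measure_ne_zero ((s.towers hns).level_pos hns _ _).ne'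
  have hsub {f c : G} (hc : c ∈ s.C (n + 1)) :
      (f * c) • (s.towers hns).A (n + 1) ⊆ f • (s.towers hns).A n := by
    rw [mul_smul]
    exact smul_set_mono (s.smul_towers_A_subset hns hc)
  obtain ⟨x, hx⟩ := hne
  obtain rfl := (s.towers hns).eq_of_mem hf hf' (hsub hc hx) (hsub hc' (h ▸ hx))
  exact mul_left_cancel h

/-- The `(C,F)`-construction given by the selected towers. -/
def shape (hns : QuasiInvariant G η) (hQ : Q 0 = {1}) (hK : ∀ n, 1 ∈ K n) : CFShape G where
  F := s.F
  C := s.C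
  F_zero := by
    classical rw [F, s.index_zero, s.base_zero, hQ, Finset.image_singleton, inv_one, mul_one]
  one_mem_F := (s.towers hns).one_mem
  one_mem_C
    | n + 1, _ => mem_C.2 ⟨_, s.base_succ_mem n, mul_inv_cancel _⟩
  one_lt_card_C
    | n + 1, _ => by
      classical rw [C, Finset.card_image_of_injective _ (mul_left_injective _)]
      exact s.one_lt_card n
  mul_mem n f hf c hc := one_mul (f * c) ▸ s.mul_mem_F (hK n) hf hc
  disjoint _ _ hc _ hc' hne _ hf _ hf' h := hne (s.eq_of_mul_eq_mul hns hf hf' hc hc' h)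

end Selection

end ExactTowers

/-- Towers `(A n, F n)` along the shapes of a `(C,F)`-construction: the levels `c A_{n+1}`,
`c ∈ C_{n+1}`, are contained in `A n` and fill all but a summable proportion of it. -/
structure CFTowers (η : Measure Z) (S : CFShape G) extends ExactTowers η S.F where
  subset : ∀ n, ∀ c ∈ S.C (n + 1), c • A (n + 1) ⊆ A n
  loss : ∀ n, η (A n \ ⋃ c ∈ S.C (n + 1), c • A (n + 1)) ≤ 2⁻¹ ^ n * η (A n)
  eventually_mul_mem : ∀ g : G, ∀ᶠ n in atTop, ∀ f ∈ S.F n, ∀ c ∈ S.C (n + 1),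
    g * (f * c) ∈ S.F (n + 1)

/-- The selected towers as towers along a `(C,F)`-construction. -/
def ExactTowers.Selection.cfTowers {Q : ℕ → Finset G} {T : ExactTowers η Q} {K : ℕ → Finset G}
    (s : T.Selection K) (hns : QuasiInvariant G η) (hQ : Q 0 = {1}) (hK : ∀ n, 1 ∈ K n)
    (hKG : ∀ g : G, ∀ᶠ n in atTop, g ∈ K n) : CFTowers η (s.shape hns hQ hK) where
  toExactTowers := s.towers hns
  subset _ _ hc := s.smul_towers_A_subset hns hc
  loss n := by
    change η (_ \ ⋃ c ∈ s.C (n + 1), _) ≤ _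
    simp only [ExactTowers.Selection.C, Finset.set_biUnion_finset_image, s.smul_towers_A hns]
    exact s.loss n
  eventually_mul_mem g := (hKG g).mono fun n hg f hf c hc => s.mul_mem_F hg hf hc

lemma exists_finset_exhaustion (G : Type*) [Countable G] [One G] :
    ∃ K : ℕ → Finset G, (∀ n, 1 ∈ K n) ∧ ∀ g : G, ∀ᶠ n in atTop, g ∈ K n := by
  classical
  have : Nonempty G := ⟨1⟩
  obtain ⟨e, he⟩ := exists_surjective_nat G
  refine ⟨fun n => insert 1 ((Finset.range (n + 1)).image e), fun n => Finset.mem_insert_self _ _,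
    fun g => ?_⟩
  obtain ⟨i, rfl⟩ := he g
  filter_upwards [eventually_ge_atTop i] with n hn
  exact Finset.mem_insert_of_mem (Finset.mem_image_of_mem _ (Finset.mem_range_succ_iff.2 hn))

theorem ExactTowers.exists_cfTowers [Countable G] [NullSingletonClass η] {Q : ℕ → Finset G}
    (T : ExactTowers η Q) (hns : QuasiInvariant G η) (hQ : Q 0 = {1}) :
    ∃ (S : CFShape G) (_ : CFTowers η S) (z : ℕ → G) (l : ℕ → ℕ), (∀ n, z n ∈ Q n) ∧
      StrictMono l ∧
      ∀ n, (S.F n : Set G) = (fun q => q * (z (l n))⁻¹) '' (Q (l n) : Set G) := by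
  obtain ⟨K, hK, hKG⟩ := exists_finset_exhaustion G
  obtain ⟨s⟩ := T.nonempty_selection hns K
  refine ⟨_, s.cfTowers hns hQ hK hKG, Function.extend s.index s.base fun _ => 1, s.index,
    fun m => ?_, s.strictMono, fun n => ?_⟩
  · by_cases h : ∃ n, s.index n = m
    · obtain ⟨n, rfl⟩ := h
      rw [s.strictMono.injective.extend_apply]
      exact s.base_mem n
    · rw [Function.extend_apply' _ _ _ h]
      exact T.one_mem m
  · rw [s.strictMono.injective.extend_apply]
    ext f
    exact Selection.mem_F

/-! ### The coding of points by the towers -/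

namespace CFTowers

section

variable {S : CFShape G} (T : CFTowers η S)

/-- The sequence `p` codes the point `x` from `n` on: `x` lies in the level `p_k A_k` for all
`k ≥ n`. -/
structure Codes (n : ℕ) (p : ℕ → G) (x : Z) : Prop where
  isPathFrom : S.IsPathFrom n p
  mem : ∀ k, n ≤ k → x ∈ p k • T.A k

/-- The part of the `k`-th tower that is filled up by the levels of the next tower which the
`(C,F)`-construction retains. -/
def retained (k : ℕ) : Set Z := ⋃ h ∈ S.F k, ⋃ c ∈ S.C (k + 1), (h * c) • T.A (k + 1)

/-- The points of the level `f A_n` that are retained forever; they will correspond to the cylinder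
`[f]_n`. -/
def core (n : ℕ) (f : G) : Set Z := f • T.A n ∩ ⋂ k ≥ n, T.retained k

/-- The set of all points that are coded by some sequence. -/
def coded : Set Z := ⋃ n, ⋃ f ∈ S.F n, T.core n f

variable {T}

lemma mul_smul_subset {n : ℕ} {f c : G} (hc : c ∈ S.C (n + 1)) :
    (f * c) • T.A (n + 1) ⊆ f • T.A n := by
  rw [mul_smul]
  exact smul_set_mono (T.subset n c hc)

lemma mem_retained {k : ℕ} {x : Z} :
    x ∈ T.retained k ↔ ∃ h ∈ S.F k, ∃ c ∈ S.C (k + 1), x ∈ (h * c) • T.A (k + 1) := by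
  simp only [retained, mem_iUnion, exists_prop]

namespace Codes

variable {n m : ℕ} {p q : ℕ → G} {x : Z}

lemma mono (h : T.Codes n p x) (hnm : n ≤ m) : T.Codes m p x :=
  ⟨h.isPathFrom.mono hnm, fun k hk => h.mem k (hnm.trans hk)⟩

lemma of_eventually (hp : S.IsPathFrom n p) (h : ∀ᶠ k in atTop, x ∈ p k • T.A k) :
    T.Codes n p x := by
  refine ⟨hp, fun k hk => ?_⟩
  obtain ⟨N, hN, hkN⟩ := (h.and (eventually_ge_atTop k)).exists
  induction N, hkN using Nat.le_induction with
  | base => exact hN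
  | succ N hkN ih =>
    refine ih (mul_smul_subset (hp.step N (hk.trans hkN)) ?_)
    rwa [mul_inv_cancel_left]

lemma eq (hp : T.Codes n p x) (hq : T.Codes m q x) {k : ℕ} (hn : n ≤ k) (hm : m ≤ k) :
    p k = q k :=
  T.eq_of_mem (hp.isPathFrom.mem_of_le hn) (hq.isPathFrom.mem_of_le hm) (hp.mem k hn) (hq.mem k hm)

lemma mem_Ω (hp : T.Codes n p x) : x ∈ T.Ω := T.level_subset_Ω n (p n) (hp.mem n le_rfl)

lemma const_mul (hp : T.Codes n p x) {g : G} (hg : g * p n ∈ S.F n) :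
    T.Codes n (fun k => g * p k) (g • x) :=
  ⟨hp.isPathFrom.const_mul hg, fun k hk => by
    rw [mul_smul]
    exact smul_mem_smul_set (hp.mem k hk)⟩

lemma exists_const_mul (hp : T.Codes n p x) (g : G) :
    ∃ m, T.Codes m (fun k => g * p k) (g • x) := by
  obtain ⟨k, hk, hn⟩ := ((T.eventually_mul_mem g).and (eventually_ge_atTop n)).exists
  have := hk _ (hp.isPathFrom.mem_of_le hn) _ (hp.isPathFrom.step k hn)
  rw [mul_inv_cancel_left] at this
  exact ⟨k + 1, (hp.mono (by omega)).const_mul this⟩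

end Codes

lemma mem_core_iff {n : ℕ} {f : G} (hf : f ∈ S.F n) {x : Z} :
    x ∈ T.core n f ↔ ∃ p, T.Codes n p x ∧ p n = f := by
  simp only [core, mem_inter_iff, mem_iInter, mem_retained]
  constructor
  · rintro ⟨hxf, hx⟩
    choose! h hh c hc hx using hx
    have hmem (k : ℕ) (hk : k ≥ n) : x ∈ h k • T.A k := mul_smul_subset (hc k hk) (hx k hk)
    have hstep (k : ℕ) (hk : k ≥ n) : h (k + 1) = h k * c k :=
      T.eq_of_mem (hh _ (by omega)) (S.mul_mem k _ (hh k hk) _ (hc k hk))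
        (hmem (k + 1) (by omega)) (hx k hk)
    refine ⟨h, ⟨⟨hh n le_rfl, fun k hk => ?_⟩, hmem⟩,
      T.eq_of_mem (hh n le_rfl) hf (hmem n le_rfl) hxf⟩
    rw [hstep k hk, inv_mul_cancel_left]
    exact hc k hk
  · rintro ⟨p, hp, rfl⟩
    refine ⟨hp.mem n le_rfl, fun k hk =>
      ⟨p k, hp.isPathFrom.mem_of_le hk, _, hp.isPathFrom.step k hk, ?_⟩⟩
    rw [mul_inv_cancel_left]
    exact hp.mem (k + 1) (by omega)

lemma Codes.mem_core {n : ℕ} {p : ℕ → G} {x : Z} (hp : T.Codes n p x) : x ∈ T.core n (p n) :=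
  (mem_core_iff hp.isPathFrom.mem).2 ⟨p, hp, rfl⟩

lemma core_subset_coded {n : ℕ} {f : G} (hf : f ∈ S.F n) : T.core n f ⊆ T.coded :=
  subset_iUnion_of_subset n (subset_biUnion_of_mem (u := T.core n) hf)

lemma mem_coded_iff {x : Z} : x ∈ T.coded ↔ ∃ n p, T.Codes n p x := by
  constructor
  · intro hx
    obtain ⟨n, hx⟩ := mem_iUnion.1 hx
    obtain ⟨f, hf, hx⟩ := mem_iUnion₂.1 hx
    obtain ⟨p, hp, -⟩ := (mem_core_iff hf).1 hx
    exact ⟨n, p, hp⟩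
  · rintro ⟨n, p, hp⟩
    exact core_subset_coded hp.isPathFrom.mem hp.mem_core

lemma coded_subset_iUnion_core (n : ℕ) : T.coded ⊆ ⋃ k ≥ n, ⋃ f ∈ S.F k, T.core k f := by
  intro x hx
  obtain ⟨m, p, hp⟩ := mem_coded_iff.1 hx
  replace hp := hp.mono (le_max_right n m)
  exact mem_iUnion₂.2 ⟨max n m, le_max_left n m, mem_biUnion hp.isPathFrom.mem hp.mem_core⟩

lemma core_subset_level {n : ℕ} {f : G} : T.core n f ⊆ f • T.A n := inter_subset_left

lemma core_smul {n : ℕ} {f g : G} (hf : f ∈ S.F n) (hgf : g * f ∈ S.F n) :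
    T.core n (g * f) = g • T.core n f := by
  ext x
  rw [mem_smul_set_iff_inv_smul_mem, mem_core_iff hf, mem_core_iff hgf]
  constructor
  · rintro ⟨p, hp, h⟩
    exact ⟨_, hp.const_mul (by rwa [h, inv_mul_cancel_left]), by rw [h, inv_mul_cancel_left]⟩
  · rintro ⟨p, hp, rfl⟩
    exact ⟨_, smul_inv_smul g x ▸ hp.const_mul hgf, rfl⟩

lemma core_subset_core {n k : ℕ} (hnk : n ≤ k) {p : ℕ → G} (hp : S.IsPathFrom n p) :
    T.core k (p k) ⊆ T.core n (p n) := by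
  intro x hx
  obtain ⟨q, hq, h⟩ := (mem_core_iff (hp.mem_of_le hnk)).1 hx
  refine (mem_core_iff hp.mem).2 ⟨_, .of_eventually
    (hp.glue hq.isPathFrom hnk le_rfl h.symm) ?_, if_pos hnk⟩
  filter_upwards [eventually_gt_atTop k] with j hj
  rw [if_neg hj.not_ge]
  exact hq.mem j hj.le

theorem absorbing (T : CFTowers η S) : S.Absorbing := by
  intro g n _
  obtain ⟨N, hN⟩ := eventually_atTop.1 (T.eventually_mul_mem g)
  refine ⟨N + 1, N.succ_pos, ?_⟩
  rintro _ ⟨_, ⟨a, ha, c, hc, rfl⟩, rfl⟩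
  exact hN (n + N) (by omega) a (S.prodSet_subset n N ha) c hc

end

/-! ### Almost every point is coded -/

section

variable {S : CFShape G} {T : CFTowers η S} (hns : QuasiInvariant G η)
include hns

lemma measurableSet_retained (k : ℕ) : MeasurableSet (T.retained k) :=
  have := hns.measurableConstSMul
  Finset.measurableSet_biUnion _ fun _ _ => Finset.measurableSet_biUnion _ fun _ _ =>
    (T.measurableSet_A (k + 1)).const_smul _

lemma measurableSet_core (n : ℕ) (f : G) : MeasurableSet (T.core n f) :=
  have := hns.measurableConstSMul
  ((T.measurableSet_A n).const_smul f).inter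
    (.iInter fun k => .iInter fun _ => measurableSet_retained hns k)

lemma measurableSet_coded : MeasurableSet T.coded :=
  .iUnion fun n => Finset.measurableSet_biUnion _ fun f _ => measurableSet_core hns n f

lemma measure_level_sdiff_retained_self_le {n : ℕ} {f : G} (hf : f ∈ S.F n) :
    η (f • T.A n \ T.retained n) ≤ 2⁻¹ ^ n * η (f • T.A n) := by
  have := hns.measurableConstSMul
  have hsub : f • T.A n \ T.retained n ⊆ f • (T.A n \ ⋃ c ∈ S.C (n + 1), c • T.A (n + 1)) := by
    simp only [smul_set_sdiff, smul_set_iUnion, smul_smul]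
    exact sdiff_subset_sdiff_right
      (subset_biUnion_of_mem (u := fun h => ⋃ c ∈ S.C (n + 1), (h * c) • T.A (n + 1)) hf)
  have hm : MeasurableSet (⋃ c ∈ S.C (n + 1), c • T.A (n + 1)) :=
    Finset.measurableSet_biUnion _ fun c _ => (T.measurableSet_A (n + 1)).const_smul c
  obtain ⟨a, -, ha⟩ := T.scale n f hf
  calc
    η (f • T.A n \ T.retained n) ≤ η (f • (T.A n \ ⋃ c ∈ S.C (n + 1), c • T.A (n + 1))) :=
      measure_mono hsub
    _ = a * η (T.A n \ ⋃ c ∈ S.C (n + 1), c • T.A (n + 1)) :=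
      ha _ sdiff_subset ((T.measurableSet_A n).diff hm)
    _ ≤ a * (2⁻¹ ^ n * η (T.A n)) := by gcongr; exact T.loss n
    _ = 2⁻¹ ^ n * η (f • T.A n) := by
      rw [ha _ Subset.rfl (T.measurableSet_A n), mul_left_comm]

lemma measure_level_sdiff_retained_le {n k : ℕ} (hnk : n ≤ k) {f : G} (hf : f ∈ S.F n) :
    η (f • T.A n \ T.retained k) ≤ 2⁻¹ ^ k * η (f • T.A n) := by
  have := hns.measurableConstSMul
  obtain ⟨H, hH, e⟩ := T.exists_refinement hnk hf
  have hdisj : (H : Set G).PairwiseDisjoint fun h => h • T.A k :=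
    fun h hh h' hh' hne => T.disjoint k h (hH hh) h' (hH hh') hne
  calc
    η (f • T.A n \ T.retained k) = η (⋃ h ∈ H, h • T.A k \ T.retained k) := by
      rw [e]
      simp only [iUnion_sdiff]
    _ ≤ ∑ h ∈ H, η (h • T.A k \ T.retained k) := measure_biUnion_finset_le _ _
    _ ≤ ∑ h ∈ H, 2⁻¹ ^ k * η (h • T.A k) :=
      Finset.sum_le_sum fun h hh => measure_level_sdiff_retained_self_le hns (hH hh)
    _ = 2⁻¹ ^ k * η (f • T.A n) := by
      rw [← Finset.mul_sum, e,
        measure_biUnion_finset hdisj fun h _ => (T.measurableSet_A k).const_smul h]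

lemma ae_eventually_mem_retained {n : ℕ} {f : G} (hf : f ∈ S.F n) :
    ∀ᵐ x ∂η, x ∈ f • T.A n → ∀ᶠ k in atTop, x ∈ T.retained k := by
  have hle (k : ℕ) : η (f • T.A n \ T.retained (n + k)) ≤ 2⁻¹ ^ k * η (f • T.A n) := by
    refine (measure_level_sdiff_retained_le hns (n.le_add_right k) hf).trans ?_
    gcongr ?_ * _
    exact pow_le_pow_of_le_one zero_le (ENNReal.inv_le_one.2 one_le_two) (by omega)
  have hsum : ∑' k, η (f • T.A n \ T.retained (n + k)) ≠ ∞ := by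
    refine ne_top_of_le_ne_top ?_ (ENNReal.tsum_le_tsum hle)
    rw [ENNReal.tsum_mul_right, ENNReal.tsum_geometric]
    exact ENNReal.mul_ne_top (by simp) (T.level_lt_top hf).ne
  filter_upwards [ae_eventually_notMem hsum] with x hx hxf
  filter_upwards [(tendsto_sub_atTop_nat n).eventually hx, eventually_ge_atTop n] with k hk hnk
  rw [Nat.add_sub_cancel' hnk] at hk
  exact by_contra fun h => hk ⟨hxf, h⟩

lemma measure_coded_compl : η T.codedᶜ = 0 := by
  have hret : ∀ᵐ x ∂η, ∀ n, ∀ f ∈ S.F n, x ∈ f • T.A n → ∀ᶠ k in atTop, x ∈ T.retained k :=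
    ae_all_iff.2 fun n => (ae_ball_iff (S.F n).countable_toSet).2 fun f hf =>
      ae_eventually_mem_retained hns hf
  refine mem_ae_iff.1 (?_ : ∀ᵐ x ∂η, x ∈ T.coded)
  filter_upwards [hret, mem_ae_iff.2 T.measure_compl] with x hx hxΩ
  have hev := T.eventually_mem_level hxΩ
  obtain ⟨n, f, hf, hxf⟩ := hev.exists
  obtain ⟨m, hm⟩ := eventually_atTop.1 (hx n f hf hxf)
  obtain ⟨k, ⟨f', hf', hxk⟩, hk⟩ := (hev.and (eventually_ge_atTop m)).exists
  exact core_subset_coded hf' ⟨hxk, mem_iInter₂.2 fun j hj => hm j (hk.trans hj)⟩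

lemma measure_coded_pos : 0 < η T.coded := by
  refine (T.pos 0).trans_le ?_
  rw [← measure_inter_conull (measure_coded_compl hns)]
  exact measure_mono inter_subset_right

lemma coded_not_countable [NullSingletonClass η] : ¬ T.coded.Countable :=
  fun h => (measure_coded_pos hns).ne' (h.measure_zero η)

lemma core_pos {n : ℕ} {f : G} (hf : f ∈ S.F n) : 0 < η (T.core n f) := by
  have htranslate {k : ℕ} {f f' : G} (hf : f ∈ S.F k) (hf' : f' ∈ S.F k)
      (h : η (T.core k f) = 0) : η (T.core k f') = 0 := by
    have := core_smul (T := T) (g := f' * f⁻¹) hf (by simpa using hf')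
    rw [inv_mul_cancel_right] at this
    rw [this, hns.measure_smul_eq_zero_iff, h]
  refine pos_iff_ne_zero.2 fun h => (measure_coded_pos (T := T) hns).ne' ?_
  refine measure_mono_null (coded_subset_iUnion_core n) (measure_iUnion_null fun k =>
    measure_iUnion_null fun hk => (measure_biUnion_null_iff (S.F k).countable_toSet).2 fun f' hf' =>
      htranslate (S.one_mem_F k) hf' ?_)
  exact measure_mono_null (core_subset_core hk (isPathFrom_const (S.one_mem_F n)))
    (htranslate hf (S.one_mem_F n) h)

end

/-! ### The coding map into the `(C,F)`-space -/

section

variable {S : CFShape G} (T : CFTowers η S)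

open Classical in
/-- The map that sends a coded point to the point of the `(C,F)`-space with the same code; the other
points go to an arbitrary point. -/
def code (x : Z) : S.Space :=
  if h : ∃ n p, T.Codes n p x then S.point _ h.choose_spec.choose_spec.isPathFrom.toLevel
  else S.point 0 (isPathFrom_const (S.one_mem_F 0)).toLevel

variable {T}

lemma code_of_notMem {x : Z} (hx : x ∉ T.coded) :
    T.code x = S.point 0 (isPathFrom_const (S.one_mem_F 0)).toLevel :=
  dif_neg fun h => hx (mem_coded_iff.2 h)

lemma Codes.germ_code {n : ℕ} {p : ℕ → G} {x : Z} (hp : T.Codes n p x) :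
    S.germ (T.code x) = (p : Germ atTop G) := by
  have hex : ∃ n p, T.Codes n p x := ⟨n, p, hp⟩
  have hq := hex.choose_spec.choose_spec
  rw [code, dif_pos hex, hq.isPathFrom.germ_point_toLevel, Germ.coe_eq]
  filter_upwards [eventually_ge_atTop n, eventually_ge_atTop hex.choose] with k h1 h2
  exact hq.eq hp h2 h1

lemma code_mem_cylinder_iff {n : ℕ} {f : G} (hf : f ∈ S.F n) {x : Z} (hx : x ∈ T.coded) :
    T.code x ∈ S.cylinder n f ↔ x ∈ T.core n f := by
  obtain ⟨m, p, hp⟩ := mem_coded_iff.1 hx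
  rw [mem_core_iff hf, mem_cylinder_iff]
  constructor
  · rintro ⟨q, hq, rfl, h⟩
    refine ⟨q, .of_eventually hq ?_, rfl⟩
    rw [hp.germ_code, Germ.coe_eq] at h
    filter_upwards [h, eventually_ge_atTop m] with k hk hmk
    exact hk ▸ hp.mem k hmk
  · rintro ⟨q, hq, rfl⟩
    exact ⟨q, hq.isPathFrom, rfl, hq.germ_code⟩

lemma code_preimage_cylinder_inter_coded {n : ℕ} {f : G} (hf : f ∈ S.F n) :
    T.code ⁻¹' S.cylinder n f ∩ T.coded = T.core n f :=
  Subset.antisymm (fun _ hx => (code_mem_cylinder_iff hf hx.2).1 hx.1) fun _ hx =>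
    have hc := core_subset_coded hf hx
    ⟨(code_mem_cylinder_iff hf hc).2 hx, hc⟩

lemma injOn_code : InjOn T.code T.coded := by
  intro x hx y hy h
  obtain ⟨n, p, hp⟩ := mem_coded_iff.1 hx
  obtain ⟨m, q, hq⟩ := mem_coded_iff.1 hy
  have hqp := hp.germ_code
  rw [h, hq.germ_code, Germ.coe_eq] at hqp
  by_contra hne
  obtain ⟨k, ⟨heq, hsep⟩, hnk, hmk⟩ :=
    ((hqp.and (T.eventually_separate hp.mem_Ω hq.mem_Ω hne)).and
      ((eventually_ge_atTop n).and (eventually_ge_atTop m))).exists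
  exact hsep _ (hp.isPathFrom.mem_of_le hnk) (hp.mem k hnk) (heq ▸ hq.mem k hmk)

lemma code_smul [MulAction G S.Space] (hG : S.IsCFAction) {x : Z} (hx : x ∈ T.coded) (g : G) :
    T.code (g • x) = g • T.code x := by
  obtain ⟨n, p, hp⟩ := mem_coded_iff.1 hx
  obtain ⟨m, hm⟩ := hp.exists_const_mul g
  apply germ_injective
  rw [hG.germ_smul T.absorbing, hp.germ_code, hm.germ_code]
  rfl

end

section

variable {S : CFShape G} {T : CFTowers η S} [Countable G] (hns : QuasiInvariant G η)
include hns

variable [TopologicalSpace G] [DiscreteTopology G]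

lemma measurable_code : Measurable T.code := by
  have hgen := (isTopologicalBasis_cylinder (S := S) (P := fun n f => f ∈ S.F n)
    eventually_mem_cylinder).borel_eq_generateFrom
  suffices h : Measurable[_, .generateFrom {U | ∃ n, ∃ f ∈ S.F n, U = S.cylinder n f}] T.code from
    fun U hU => h (hgen.le U hU)
  refine measurable_generateFrom ?_
  rintro _ ⟨n, f, hf, rfl⟩
  rw [← inter_union_compl (T.code ⁻¹' S.cylinder n f) T.coded,
    code_preimage_cylinder_inter_coded hf]
  refine (measurableSet_core hns n f).union ?_
  have hconst : T.code ⁻¹' S.cylinder n f ∩ T.codedᶜ =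
      {_x | S.point 0 (isPathFrom_const (S.one_mem_F 0)).toLevel ∈ S.cylinder n f} ∩ T.codedᶜ := by
    ext x
    exact and_congr_left fun hx => by rw [mem_preimage, code_of_notMem hx, mem_ofPred]
  rw [hconst]
  exact (MeasurableSet.const _).inter (measurableSet_coded hns).compl

lemma map_code_apply {s : Set S.Space} (hs : MeasurableSet s) :
    η.map T.code s = η (T.code ⁻¹' s ∩ T.coded) := by
  rw [Measure.map_apply (measurable_code hns) hs, measure_inter_conull (measure_coded_compl hns)]

lemma map_code_cylinder {n : ℕ} {f : G} (hf : f ∈ S.F n) :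
    η.map T.code (S.cylinder n f) = η (T.core n f) := by
  rw [map_code_apply hns (measurableSet_cylinder n f), code_preimage_cylinder_inter_coded hf]

lemma map_code_subsingleton [NullSingletonClass η] {s : Set S.Space} (hs : s.Subsingleton) :
    η.map T.code s = 0 := by
  rw [map_code_apply hns hs.measurableSet]
  exact Set.Subsingleton.measure_zero
    (fun x hx y hy => injOn_code hx.2 hy.2 (hs hx.1 hy.1)) η

end

/-! ### The weights of the coded action -/

section

variable {S : CFShape G} (T : CFTowers η S)

/-- The measure of the part of the level `f A_n` that corresponds to the cylinder `[f]_n`. -/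
def weight (n : ℕ) (f : G) : ℝ≥0 := (η (T.core n f)).toNNReal

/-- The conditional weight `κ_n(c)` of `c ∈ C_n`, `n ≥ 1`. -/
def relWeight (n : ℕ) (c : G) : ℝ≥0 := T.weight n c / T.weight (n - 1) 1

variable {T}

lemma core_lt_top {n : ℕ} {f : G} (hf : f ∈ S.F n) : η (T.core n f) < ∞ :=
  (measure_mono core_subset_level).trans_lt (T.level_lt_top hf)

lemma coe_weight {n : ℕ} {f : G} (hf : f ∈ S.F n) : (T.weight n f : ℝ≥0∞) = η (T.core n f) :=
  ENNReal.coe_toNNReal (core_lt_top hf).ne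

end

section

variable {S : CFShape G} {T : CFTowers η S} (hns : QuasiInvariant G η)
include hns

lemma weight_pos {n : ℕ} {f : G} (hf : f ∈ S.F n) : 0 < T.weight n f :=
  ENNReal.toNNReal_pos (core_pos hns hf).ne' (core_lt_top hf).ne

lemma relWeight_pos {n : ℕ} {c : G} (hc : c ∈ S.C (n + 1)) : 0 < T.relWeight (n + 1) c :=
  div_pos (weight_pos hns (S.C_subset_F n hc)) (weight_pos hns (S.one_mem_F n))

-- Translation by `f` scales the measure of all subsets of `A_n` by the same factor.
lemma weight_mul {n : ℕ} {f c : G} (hf : f ∈ S.F n) (hc : c ∈ S.C (n + 1)) :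
    T.weight (n + 1) (f * c) = T.weight n f * T.relWeight (n + 1) c := by
  have h1 := S.one_mem_F n
  have hcF := S.C_subset_F n hc
  have hfc := S.mul_mem n f hf c hc
  have hsub_one : T.core n 1 ⊆ T.A n := core_subset_level.trans (one_smul G _).subset
  have hsub_c : T.core (n + 1) c ⊆ T.A n := core_subset_level.trans (T.subset n c hc)
  obtain ⟨a, -, ha⟩ := T.scale n f hf
  have hweight_mul : T.weight (n + 1) (f * c) = a * T.weight (n + 1) c := by
    rw [← ENNReal.coe_inj, ENNReal.coe_mul, coe_weight hfc, coe_weight hcF, core_smul hcF hfc,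
      ha _ hsub_c (measurableSet_core hns _ _)]
  have hweight : T.weight n f = a * T.weight n 1 := by
    have := core_smul (T := T) (g := f) h1 (by rwa [mul_one])
    rw [mul_one] at this
    rw [← ENNReal.coe_inj, ENNReal.coe_mul, coe_weight hf, coe_weight h1, this,
      ha _ hsub_one (measurableSet_core hns _ _)]
  rw [hweight_mul, hweight, relWeight, Nat.add_sub_cancel, mul_assoc,
    mul_div_cancel₀ _ (weight_pos hns h1).ne']

lemma exists_isPathFrom_prod_sup_relWeight_eq : ∃ p : ℕ → G, S.IsPathFrom 0 p ∧
    ∀ N : ℕ, ∏ n ∈ Finset.Icc 1 N, (S.C n).sup (T.relWeight n) =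
      T.weight N (p N) / T.weight 0 1 := by
  have hsup (n : ℕ) :
      ∃ c ∈ S.C (n + 1), (S.C (n + 1)).sup (T.relWeight (n + 1)) = T.relWeight (n + 1) c :=
    Finset.exists_mem_eq_sup _ ⟨1, S.one_mem_C (n + 1) n.succ_pos⟩ _
  choose c hc hsup using hsup
  let p : ℕ → G := fun n => Nat.rec 1 (fun n a => a * c n) n
  have hp : S.IsPathFrom 0 p :=
    ⟨S.one_mem_F 0, fun k _ => (inv_mul_cancel_left (p k) (c k)).symm ▸ hc k⟩
  refine ⟨p, hp, fun N => ?_⟩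
  induction N with
  | zero => exact (div_self (weight_pos (T := T) hns (S.one_mem_F 0)).ne').symm
  | succ N ih =>
    rw [Finset.prod_Icc_succ_top (by omega), ih, hsup, div_mul_eq_mul_div,
      ← weight_mul hns (hp.mem_of_le N.zero_le) (hc N)]

variable [TopologicalSpace G] [DiscreteTopology G] [Countable G]

lemma sum_weight (n : ℕ) : ∑ c ∈ S.C (n + 1), T.weight (n + 1) c = T.weight n 1 := by
  have h1 := S.one_mem_F n
  rw [← ENNReal.coe_inj, coe_weight h1, ENNReal.ofNNReal_finsetSum, ← map_code_cylinder hns h1,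
    measure_cylinder_eq_sum _ h1]
  refine Finset.sum_congr rfl fun c hc => ?_
  have hcF := S.C_subset_F n hc
  rw [coe_weight hcF, one_mul, map_code_cylinder hns hcF]

variable [NullSingletonClass η]

lemma tendsto_weight {p : ℕ → G} (hp : S.IsPathFrom 0 p) :
    Tendsto (fun n => T.weight n (p n)) atTop (𝓝 0) := by
  have hF (n : ℕ) : p n ∈ S.F n := hp.mem_of_le n.zero_le
  have hlim := tendsto_measure_iInter_atTop (μ := η.map T.code) (s := fun n => S.cylinder n (p n))
    (fun n => (measurableSet_cylinder n _).nullMeasurableSet)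
    (fun n m hnm => (hp.mono n.zero_le).cylinder_subset hnm)
    ⟨0, by rw [map_code_cylinder hns (hF 0)]; exact (core_lt_top (hF 0)).ne⟩
  have hs : (⋂ n, S.cylinder n (p n)).Subsingleton := by
    simpa using subsingleton_iInter_cylinder (S := S) (n := 0) p
  rw [map_code_subsingleton hns hs] at hlim
  rw [← ENNReal.tendsto_coe]
  refine hlim.congr fun n => ?_
  rw [Function.comp_apply, map_code_cylinder hns (hF n), coe_weight (hF n)]

variable (T) in
/-- The weights of the image of the given measure under the coding map. -/
def cfWeights : CFWeights S where
  κ := T.relWeight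
  ν := T.weight
  κ_pos
    | _ + 1, _, _, hc => relWeight_pos hns hc
  κ_sum
    | n + 1, _ => by
      simp only [relWeight, Nat.add_sub_cancel]
      rw [← Finset.sum_div, sum_weight hns, div_self (weight_pos hns (S.one_mem_F n)).ne']
  ν_pos _ _ := weight_pos hns
  prod_max := by
    obtain ⟨p, hp, hprod⟩ := exists_isPathFrom_prod_sup_relWeight_eq (T := T) hns
    simpa [hprod] using (tendsto_weight (T := T) hns hp).div_const (T.weight 0 1)
  ν_mul _ _ hf _ hc := weight_mul hns hf hc

theorem isCFMeasure_map_code : (T.cfWeights hns).IsCFMeasure (η.map T.code) := fun _ _ hf =>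
  (map_code_cylinder hns hf).trans (coe_weight hf).symm

end

end CFTowers

end RankOne

end

theorem theorem1p19 {G : Type*} [Group G] [Countable G] [Infinite G]
    [TopologicalSpace G] [DiscreteTopology G]
    {Z : Type*} [MeasurableSpace Z] [StandardBorelSpace Z] [MulAction G Z]
    (η : Measure Z) [SigmaFinite η] [NullSingletonClass η]
    (hns : RankOne.QuasiInvariant G η) (hfree : RankOne.FreeAE G η)
    (Q : ℕ → Finset G) (hQ : RankOne.IsRankOneAlong η Q) :
    ∃ (S : RankOne.CFShape G) (w : RankOne.CFWeights S) (_ : MulAction G S.Space)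
      (μ' : Measure S.Space),
      -- the model is the `(C,F)`-action of a parameter sequence with the absorbing property
      S.Absorbing ∧ S.IsCFAction ∧ w.IsCFMeasure μ' ∧
      -- its space is a locally compact Cantor space, and the action is continuous, minimal, free
      -- and Radon uniquely ergodic
      RankOne.IsLocallyCompactCantor S.Space ∧ ContinuousConstSMul G S.Space ∧
      MulAction.IsMinimal G S.Space ∧ (∀ g : G, g ≠ 1 → ∀ x : S.Space, g • x ≠ x) ∧
      RankOne.IsRadonUniquelyErgodic G S.Space ∧
      (∃! ξ : Measure S.Space, ξ.Regular ∧ SMulInvariantMeasure G S.Space ξ ∧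
        ξ (Set.range (S.point 0)) = 1) ∧
      -- its measure is Radon and quasi-invariant, its derivatives are continuous, and the action is
      -- Radon uniquely ergodic for the Radon-Nikodym cocycle
      μ'.Regular ∧ RankOne.QuasiInvariant G μ' ∧
      (∃ ρ : G → S.Space → ℝ≥0, RankOne.IsCocycle ρ ∧ (∀ g, Continuous (ρ g)) ∧
        RankOne.HasRNCocycle μ' ρ ∧ RankOne.IsRadonCocycleUniquelyErgodic ρ) ∧
      -- it is isomorphic to the given action
      (∃ φ : Z ≃ᵐ S.Space, MeasurePreserving φ η μ' ∧
        ∀ g : G, ∀ᵐ z ∂η, φ (g • z) = g • φ z) ∧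
      -- its shapes are translates of shapes from a subsequence of the given sequence
      (∃ (z : ℕ → G) (l : ℕ → ℕ), (∀ n, z n ∈ Q n) ∧ StrictMono l ∧
        ∀ n, 1 ≤ n → (S.F n : Set G) = (fun q => q * (z (l n))⁻¹) '' (Q (l n) : Set G)) := by
  obtain ⟨E⟩ := hQ.nonempty_exactTowers hns hfree
  obtain ⟨S, T, z, l, hz, hl, hF⟩ := E.exists_cfTowers hns hQ.1
  have hA : S.Absorbing := T.absorbing
  let := hA.mulAction
  have hG : S.IsCFAction := hA.isCFAction
  have hμ := RankOne.CFTowers.isCFMeasure_map_code (T := T) hns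
  have hρ := hμ.hasRNCocycle hA hG
  have : StandardBorelSpace S.Space := RankOne.standardBorelSpace_of_locallyCompact
  have hcoded : η T.codedᶜ = 0 := RankOne.CFTowers.measure_coded_compl hns
  obtain ⟨φ, hφ⟩ := RankOne.exists_measurableEquiv_ae_eq η
    (RankOne.CFTowers.measurableSet_coded hns) (RankOne.CFTowers.coded_not_countable hns) hcoded
    (RankOne.CFTowers.measurable_code hns) RankOne.CFTowers.injOn_code
  refine ⟨S, T.cfWeights hns, inferInstance, η.map T.code, hA, hG, hμ, S.isLocallyCompactCantor,
    hG.continuousConstSMul hA, hG.isMinimal, fun g hg => hG.smul_ne hA hg,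
    hG.isRadonUniquelyErgodic hA, hG.existsUnique_regular_invariant hA,
    hμ.regular, hρ.1, ⟨_, (T.cfWeights hns).isCocycle_cocycle hA hG,
      (T.cfWeights hns).continuous_cocycle hA, hρ, hμ.isRadonCocycleUniquelyErgodic hA hG⟩,
    ⟨φ, ⟨φ.measurable, Measure.map_congr hφ⟩, fun g => ?_⟩, z, l, hz, hl, fun n _ => hF n⟩
  filter_upwards [hφ, (hns g).ae hφ, mem_ae_iff.2 hcoded] with x hx hgx hxc
  rw [hx, hgx, RankOne.CFTowers.code_smul hG hxc]
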